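/- **Setting.** Let $\gamma>0$, $n_{\rm th}\ge 0$ and $\Delta_A,g\in\mathbb R$. Consider an oscillator (annihilation operator $a$) coupled to a qubit, with density matrix evolving by $\dot\rho=\mathcal L_A\otimes\mathcal I_B(\rho)+\mathcal L_{\rm int}(\rho)$, where $$\mathcal L_A=-i\Delta_A[a^\dagger a,\cdot\,]+\gamma(1+n_{\rm th})\mathcal D[a]+\gamma n_{\rm th}\mathcal D[a^\dagger],\qquad \mathcal L_{\rm int}=-ig[a^\dagger\otimes\sigma_-+a\otimes\sigma_+,\cdot\,],$$ $\mathcal D[L]\rho=L\rho L^\dagger-\frac12(L^\dagger L\rho+\rho L^\dagger L)$ and $\sigma_\pm=(\sigma_x\pm i\sigma_y)/2$. Let $\bar\rho_A\propto\big(\tfrac{n_{\rm th}}{1+n_{\rm th}}\big)^{a^\dagger a}$ be the trace-one steady state of $\mathcal L_A$. An adiabatic elimination up to fourth order in the partial trace parametrization consists of linear maps $\mathcal K_n$ from qubit operators to operators of the composite system with rapidly decreasing matrix elements in the Fock basis, and qubit superoperators $\mathcal L_{s,n}$ ($0\le n\le 4$; powers of the expansion parameter $\epsilon = |g|/\gamma$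 are absorbed), such that $\mathcal K_0(\rho)=\bar\rho_A\otimes\rho$, $\mathcal L_{s,0}=0$, ${\rm tr}_A\circ\mathcal K_n=0$ for $1\le n\le4$, and $$(\mathcal L_A\otimes\mathcal I_B)\circ\mathcal K_n+\mathcal L_{\rm int}\circ\mathcal K_{n-1}=\sum_{k=0}^n\mathcal K_k\circ\mathcal L_{s,n-k}\qquad(1\le n\le 4).$$ Put $n_+=n_{\rm th}$, $n_-=1+n_{\rm th}$, $\bar\gamma=\gamma+2i\Delta_A$, $$b_\pm=\frac{2g^2n_\pm}{\bar\gamma}+\frac{8g^4n_\pm^2}{\bar\gamma^3}+\frac{8g^4n_+n_-(1+8i\gamma\Delta_A/|\bar\gamma|^2)}{\bar\gamma^*|\bar\gamma|^2},\qquad \omega_B^{(4)}={\rm Im}(b_-+b_+),\qquad\gamma_\pm^{(4)}=2\,{\rm Re}(b_\pm),$$ $$\gamma_\phi^{(4)}=-\frac{8g^4n_+n_-\big(3-6(2\Delta_A/\gamma)^2-(2\Delta_A/\gamma)^4\big)}{\gamma^3\big(1+(2\Delta_A/\gamma)^2\big)^3},$$ $$\mathcal L_s^{G=0}=-\frac{i\omega_B^{(4)}}2[\sigma_z,\cdot\,]+\gamma_-^{(4)}\mathcal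 D[\sigma_-]+\gamma_+^{(4)}\mathcal D[\sigma_+]+\gamma_\phi^{(4)}\mathcal D[\sigma_z].$$ For a linear superoperator $G$ of the qubit (a gauge choice) with $\mathcal I_B+G$ invertible, $\mathcal L_s^G$ denotes the linear generator of the evolution of $\rho_s$, where $\rho_B=\rho_s+G(\rho_s)$ evolves by $\dot\rho_B=\mathcal L_s^{G=0}(\rho_B)$; that is, a curve $\rho_s(t)$ satisfies $\dot\rho_s=\mathcal L_s^G(\rho_s)$ if and only if $\rho_s+G(\rho_s)$ satisfies the equation for $\rho_B$. **Theorem.** (i) Every adiabatic elimination up to fourth order in the partial trace parametrization has $\sum_{n=0}^4\mathcal L_{s,n}=\mathcal L_s^{G=0}$. (ii) If $\gamma_\phi^{(4)}<0$, then for every gauge choice $G$ with $\mathcal I_B+G$ invertible, $\mathcal L_s^G$ is not in the Lindblad form: there are no Hermitian matrix $H$ and finitely many matrices $J_k$ with $\mathcal L_s^G=-i[H,\cdot\,]+\sum_k\mathcal D[J_k]$. -/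

import Mathlib

open scoped Kronecker Matrix

noncomputable section

namespace JaynesCummings

/-! ### Qubit superoperators -/

/-- Operators on the qubit Hilbert space. -/
abbrev QubitOp := Matrix (Fin 2) (Fin 2) ℂ

/-- Superoperators of the qubit. -/
abbrev QubitSuperop := Module.End ℂ QubitOp

/-- The commutator superoperator `ρ ↦ H ρ - ρ H`. -/
def qubitCommutator (H : QubitOp) : QubitSuperop :=
  LinearMap.mulLeft ℂ H - LinearMap.mulRight ℂ H

/-- The dissipator `D[J] ρ = J ρ J† - (J† J ρ + ρ J† J) / 2`. -/
def qubitDissipator (J : QubitOp) : QubitSuperop :=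
  LinearMap.mulLeft ℂ J ∘ₗ LinearMap.mulRight ℂ Jᴴ
    - (1 / 2 : ℂ) • (LinearMap.mulLeft ℂ (Jᴴ * J) + LinearMap.mulRight ℂ (Jᴴ * J))

/-- `L` is in the Lindblad form: `L = -i [H, ·] + ∑ₖ D[Jₖ]` with `H` Hermitian. -/
def IsLindblad (L : QubitSuperop) : Prop :=
  ∃ H : QubitOp, H.IsHermitian ∧ ∃ (r : ℕ) (J : Fin r → QubitOp),
    L = (-Complex.I) • qubitCommutator H + ∑ k, qubitDissipator (J k)

def sigmaX : QubitOp := !![0, 1; 1, 0]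

def sigmaY : QubitOp := !![0, -Complex.I; Complex.I, 0]

def sigmaZ : QubitOp := !![1, 0; 0, -1]

def sigmaPlus : QubitOp := (1 / 2 : ℂ) • (sigmaX + Complex.I • sigmaY)

def sigmaMinus : QubitOp := (1 / 2 : ℂ) • (sigmaX - Complex.I • sigmaY)

/-! ### The oscillator-qubit system

Operators of the oscillator, and of the composite system, are represented by their infinite
matrices in the Fock basis (tensored with the standard basis of the qubit). -/

/-- The product of two infinite matrices.  Below, at least one of the two factors always has only
finitely many nonzero entries in each row and in each column, so that the sums are finite. -/
def infMul {ι : Type} (A B : Matrix ι ι ℂ) : Matrix ι ι ℂ :=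
  Matrix.of fun i j => ∑' k, A i k * B k j

/-- Operators on the composite oscillator-qubit system. -/
abbrev TotalOp := Matrix (ℕ × Fin 2) (ℕ × Fin 2) ℂ

/-- The annihilation operator of the oscillator, `a |n⟩ = √n |n - 1⟩`. -/
def annihilation : Matrix ℕ ℕ ℂ :=
  Matrix.of fun m n => if n = m + 1 then ((Real.sqrt n : ℝ) : ℂ) else 0

/-- The creation operator of the oscillator. -/
def creation : Matrix ℕ ℕ ℂ := annihilationᴴ

/-- `A X - X A` for operators on the composite system. -/
def totalCommutator (A X : TotalOp) : TotalOp := infMul A X - infMul X A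

/-- `D[J] X` for operators on the composite system. -/
def totalDissipator (J X : TotalOp) : TotalOp :=
  infMul (infMul J X) Jᴴ
    - (1 / 2 : ℂ) • (infMul (infMul Jᴴ J) X + infMul X (infMul Jᴴ J))

/-- The fast generator `L_A ⊗ I_B`, with
`L_A = -i Δ [a† a, ·] + γ (1 + n_th) D[a] + γ n_th D[a†]`. -/
def fastGenerator (Δ γ nth : ℝ) (X : TotalOp) : TotalOp :=
  (-Complex.I * Δ) • totalCommutator (infMul creation annihilation ⊗ₖ (1 : QubitOp)) X
    + ((γ * (1 + nth) : ℝ) : ℂ) • totalDissipator (annihilation ⊗ₖ (1 : QubitOp)) X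
    + ((γ * nth : ℝ) : ℂ) • totalDissipator (creation ⊗ₖ (1 : QubitOp)) X

/-- The Jaynes-Cummings interaction `-i g [a† ⊗ σ₋ + a ⊗ σ₊, ·]`. -/
def interaction (g : ℝ) (X : TotalOp) : TotalOp :=
  (-Complex.I * g) •
    totalCommutator (creation ⊗ₖ sigmaMinus + annihilation ⊗ₖ sigmaPlus) X

/-- The steady state `r ^ (a† a) / tr (r ^ (a† a))` of `L_A`, with `r = n_th / (1 + n_th)`. -/
def thermalState (nth : ℝ) : Matrix ℕ ℕ ℂ :=
  Matrix.diagonal fun m =>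
    (((nth / (1 + nth)) ^ m / ∑' k : ℕ, (nth / (1 + nth)) ^ k : ℝ) : ℂ)

/-- The partial trace over the oscillator. -/
def traceA (X : TotalOp) : QubitOp :=
  Matrix.of fun i j => ∑' m : ℕ, X (m, i) (m, j)

/-- The matrix elements of `X` in the Fock basis decay faster than every power of the occupation
numbers.  On such operators the partial trace, the fast generator and the interaction (and all
their compositions) are given by absolutely convergent sums. -/
def RapidlyDecreasing (X : TotalOp) : Prop :=
  ∀ p : ℕ, ∃ C : ℝ, ∀ (m n : ℕ) (i j : Fin 2),
    ((m : ℝ) + n + 1) ^ p * ‖X (m, i) (n, j)‖ ≤ C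

/-- Adiabatic elimination of the oscillator up to order `N`, in the partial trace parametrization.
`K n` and `Ls n` are the contributions of order `n` (the power `ε ^ n` of the expansion parameter
is absorbed into them), and `invariance` is the relation `K ∘ Ls = L_tot ∘ K` at order `n + 1`. -/
structure IsPartialTraceElimination (Δ γ nth g : ℝ) (N : ℕ)
    (K : ℕ → QubitOp →ₗ[ℂ] TotalOp) (Ls : ℕ → QubitSuperop) : Prop where
  decay : ∀ n ≤ N, ∀ ρ, RapidlyDecreasing (K n ρ)
  K_zero : ∀ ρ, K 0 ρ = thermalState nth ⊗ₖ ρ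
  Ls_zero : Ls 0 = 0
  invariance : ∀ n < N, ∀ ρ,
    fastGenerator Δ γ nth (K (n + 1) ρ) + interaction g (K n ρ)
      = ∑ k ∈ Finset.range (n + 2), K k (Ls (n + 1 - k) ρ)
  gauge : ∀ n, 1 ≤ n → n ≤ N → ∀ ρ, traceA (K n ρ) = 0

/-! ### The fourth-order generator of the qubit -/

/-- `γ + 2 i Δ`. -/
def gammaBar (Δ γ : ℝ) : ℂ := γ + 2 * Complex.I * Δ

/-- The coefficient `b₊` (for `n = n₊ = n_th`) and `b₋` (for `n = n₋ = 1 + n_th`). -/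
def bCoeff (Δ γ nth g n : ℝ) : ℂ :=
  2 * g ^ 2 * n / gammaBar Δ γ
    + 8 * g ^ 4 * n ^ 2 / gammaBar Δ γ ^ 3
    + 8 * g ^ 4 * nth * (1 + nth)
        * (1 + 8 * Complex.I * γ * Δ / ((‖gammaBar Δ γ‖ ^ 2 : ℝ) : ℂ))
      / (star (gammaBar Δ γ) * ((‖gammaBar Δ γ‖ ^ 2 : ℝ) : ℂ))

def omegaB (Δ γ nth g : ℝ) : ℝ :=
  (bCoeff Δ γ nth g (1 + nth) + bCoeff Δ γ nth g nth).im

def gammaPlus (Δ γ nth g : ℝ) : ℝ := 2 * (bCoeff Δ γ nth g nth).re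

def gammaMinus (Δ γ nth g : ℝ) : ℝ := 2 * (bCoeff Δ γ nth g (1 + nth)).re

def gammaPhi (Δ γ nth g : ℝ) : ℝ :=
  -(8 * g ^ 4 * nth * (1 + nth) * (3 - 6 * (2 * Δ / γ) ^ 2 - (2 * Δ / γ) ^ 4))
    / (γ ^ 3 * (1 + (2 * Δ / γ) ^ 2) ^ 3)

/-- The fourth-order generator of the qubit in the partial trace parametrization. -/
def reducedGenerator (Δ γ nth g : ℝ) : QubitSuperop :=
  (-Complex.I * ((omegaB Δ γ nth g / 2 : ℝ) : ℂ)) • qubitCommutator sigmaZ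
    + ((gammaMinus Δ γ nth g : ℝ) : ℂ) • qubitDissipator sigmaMinus
    + ((gammaPlus Δ γ nth g : ℝ) : ℂ) • qubitDissipator sigmaPlus
    + ((gammaPhi Δ γ nth g : ℝ) : ℂ) • qubitDissipator sigmaZ

/-! ### Gauge choices -/

/-- `ρ : ℝ → QubitOp` solves `dρ/dt = L ρ` (entrywise derivatives). -/
def IsSolution (L : QubitSuperop) (ρ : ℝ → QubitOp) : Prop :=
  ∀ t i j, HasDerivAt (fun s => ρ s i j) (L (ρ t) i j) t

/-- `LG` is the generator in the gauge `G` of the dynamics that `L` generates in the partial trace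
parametrization: `ρ_s` evolves with `LG` exactly if `ρ_B = ρ_s + G ρ_s` evolves with `L`. -/
def IsGeneratorInGauge (L G LG : QubitSuperop) : Prop :=
  ∀ ρs : ℝ → QubitOp, IsSolution LG ρs ↔ IsSolution L fun t => ρs t + G (ρs t)

end JaynesCummings

end

open scoped Kronecker Matrix

noncomputable section

namespace JaynesCummings

/-! (i) The maps `K n` never have to be constructed. Only the qubit matrices `moment p q X`, the
partial traces of `a ^ q X (a†) ^ p`, are needed. In the Heisenberg picture the damped oscillator
acts triangularly on normally ordered monomials: `fastGenerator` multiplies the moment `(p, q)` by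
`-momentRate` and adds a multiple of the moment `(p - 1, q - 1)` (`moment_fastGenerator`), while the
interaction changes `p + q` by one (`moment_interaction`). Since the rates with `p + q ≠ 0` do not
vanish, the invariance relation determines the moments of `K (n + 1)` from lower ones
(`moment_succ`), and its partial trace expresses `Ls (n + 1)` through the moments `(1, 0)` and `(0,
1)` of `K n` (`Ls_succ`). The recursion starts at the thermal moments. Up to fourth order it
involves finitely many moments, and it ends in a rational identity for 2 × 2 matrices
(`fourth_order_of_moment_equations`). Rapid decay justifies the index shifts that make the trace
cyclic.

(ii) A gauge change is a similarity, `(1 + G) LG = L (1 + G)` (`intertwine`), so it preserves the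
trace and the eigenvalues. A qubit Lindblad generator with a real eigenvalue `lam` satisfies `tr L ≤
2 lam`: no decay rate exceeds half of their sum (`IsLindblad.trace_le`). The reduced generator has
the eigenvalues `0`, `-s` and `-s / 2 - 2 γ_φ ± i ω` with `s = γ₋ + γ₊`, hence the trace `-2 s - 4
γ_φ`. With `lam = -s` the bound says exactly `γ_φ ≥ 0`. -/

/-! ### Ladder superoperators -/

/-- `X ↦ a X`. -/
def leftAnn : Module.End ℂ TotalOp where
  toFun X := Matrix.of fun x y => ((√(x.1 + 1 : ℕ) : ℝ) : ℂ) * X (x.1 + 1, x.2) y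
  map_add' X Y := by ext; simp [mul_add]
  map_smul' c X := by ext; simp; ring

/-- `X ↦ a† X`. -/
def leftCre : Module.End ℂ TotalOp where
  toFun X := Matrix.of fun x y => ((√(x.1 : ℕ) : ℝ) : ℂ) * X (x.1 - 1, x.2) y
  map_add' X Y := by ext; simp [mul_add]
  map_smul' c X := by ext; simp; ring

/-- `X ↦ X a`. -/
def rightAnn : Module.End ℂ TotalOp where
  toFun X := Matrix.of fun x y => ((√(y.1 : ℕ) : ℝ) : ℂ) * X x (y.1 - 1, y.2)
  map_add' X Y := by ext; simp [mul_add]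
  map_smul' c X := by ext; simp; ring

/-- `X ↦ X a†`. -/
def rightCre : Module.End ℂ TotalOp where
  toFun X := Matrix.of fun x y => ((√(y.1 + 1 : ℕ) : ℝ) : ℂ) * X x (y.1 + 1, y.2)
  map_add' X Y := by ext; simp [mul_add]
  map_smul' c X := by ext; simp; ring

/-- `X ↦ (1 ⊗ B) X`. -/
def leftQubit (B : QubitOp) : Module.End ℂ TotalOp where
  toFun X := Matrix.of fun x y => ∑ s, B x.2 s * X (x.1, s) y
  map_add' X Y := by ext; simp [mul_add]; ring
  map_smul' c X := by ext; simp; ring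

/-- `X ↦ X (1 ⊗ B)`. -/
def rightQubit (B : QubitOp) : Module.End ℂ TotalOp where
  toFun X := Matrix.of fun x y => ∑ s, X x (y.1, s) * B s y.2
  map_add' X Y := by ext; simp [add_mul]; ring
  map_smul' c X := by ext; simp; ring

lemma leftAnn_apply (X : TotalOp) (m : ℕ) (i : Fin 2) (y : ℕ × Fin 2) :
    leftAnn X (m, i) y = ((√(m + 1 : ℕ) : ℝ) : ℂ) * X (m + 1, i) y := rfl

lemma leftCre_apply (X : TotalOp) (m : ℕ) (i : Fin 2) (y : ℕ × Fin 2) :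
    leftCre X (m, i) y = ((√(m : ℕ) : ℝ) : ℂ) * X (m - 1, i) y := rfl

lemma rightAnn_apply (X : TotalOp) (x : ℕ × Fin 2) (n : ℕ) (j : Fin 2) :
    rightAnn X x (n, j) = ((√(n : ℕ) : ℝ) : ℂ) * X x (n - 1, j) := rfl

lemma rightCre_apply (X : TotalOp) (x : ℕ × Fin 2) (n : ℕ) (j : Fin 2) :
    rightCre X x (n, j) = ((√(n + 1 : ℕ) : ℝ) : ℂ) * X x (n + 1, j) := rfl

lemma leftQubit_apply (B : QubitOp) (X : TotalOp) (m : ℕ) (i : Fin 2) (y : ℕ × Fin 2) :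
    leftQubit B X (m, i) y = ∑ s, B i s * X (m, s) y := rfl

lemma rightQubit_apply (B : QubitOp) (X : TotalOp) (x : ℕ × Fin 2) (n : ℕ) (j : Fin 2) :
    rightQubit B X x (n, j) = ∑ s, X x (n, s) * B s j := rfl

lemma ofReal_sqrt_natCast_mul_self (m : ℕ) :
    ((√(m : ℝ) : ℝ) : ℂ) * ((√(m : ℝ) : ℝ) : ℂ) = m := by
  rw [← Complex.ofReal_mul, Real.mul_self_sqrt (Nat.cast_nonneg m), Complex.ofReal_natCast]

lemma leftCre_leftAnn_apply (X : TotalOp) (m : ℕ) (i : Fin 2) (y : ℕ × Fin 2) :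
    leftCre (leftAnn X) (m, i) y = m * X (m, i) y := by
  rw [leftCre_apply, leftAnn_apply, ← mul_assoc]
  -- At `m = 0` the truncated index `m - 1` is harmless, because its coefficient `√0` vanishes.
  rcases m with _ | m
  · simp
  · simp only [Nat.add_sub_cancel, ofReal_sqrt_natCast_mul_self]

lemma leftAnn_leftCre_apply (X : TotalOp) (m : ℕ) (i : Fin 2) (y : ℕ × Fin 2) :
    leftAnn (leftCre X) (m, i) y = (m + 1 : ℕ) * X (m, i) y := by
  rw [leftAnn_apply, leftCre_apply, ← mul_assoc, ofReal_sqrt_natCast_mul_self, Nat.add_sub_cancel]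

lemma rightAnn_rightCre_apply (X : TotalOp) (x : ℕ × Fin 2) (n : ℕ) (j : Fin 2) :
    rightAnn (rightCre X) x (n, j) = n * X x (n, j) := by
  rw [rightAnn_apply, rightCre_apply, ← mul_assoc]
  rcases n with _ | n
  · simp
  · simp only [Nat.add_sub_cancel, ofReal_sqrt_natCast_mul_self]

lemma rightCre_rightAnn_apply (X : TotalOp) (x : ℕ × Fin 2) (n : ℕ) (j : Fin 2) :
    rightCre (rightAnn X) x (n, j) = (n + 1 : ℕ) * X x (n, j) := by
  rw [rightCre_apply, rightAnn_apply, ← mul_assoc, ofReal_sqrt_natCast_mul_self,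
    Nat.add_sub_cancel]

/-! ### Commutation relations of the ladder superoperators -/

lemma leftAnn_mul_leftCre : leftAnn * leftCre = leftCre * leftAnn + 1 := by
  ext X ⟨m, i⟩ y
  simp only [Module.End.mul_apply, LinearMap.add_apply, Matrix.add_apply, Module.End.one_apply,
    leftAnn_leftCre_apply, leftCre_leftAnn_apply]
  push_cast; ring

lemma rightCre_mul_rightAnn : rightCre * rightAnn = rightAnn * rightCre + 1 := by
  ext X x ⟨n, j⟩
  simp only [Module.End.mul_apply, LinearMap.add_apply, Matrix.add_apply, Module.End.one_apply,
    rightCre_rightAnn_apply, rightAnn_rightCre_apply]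
  push_cast; ring

lemma commute_leftAnn_rightAnn : Commute leftAnn rightAnn := by
  ext X ⟨m, i⟩ ⟨n, j⟩
  simp only [Module.End.mul_apply, leftAnn_apply, rightAnn_apply]; ring

lemma commute_leftAnn_rightCre : Commute leftAnn rightCre := by
  ext X ⟨m, i⟩ ⟨n, j⟩
  simp only [Module.End.mul_apply, leftAnn_apply, rightCre_apply]; ring

lemma commute_leftCre_rightCre : Commute leftCre rightCre := by
  ext X ⟨m, i⟩ ⟨n, j⟩
  simp only [Module.End.mul_apply, leftCre_apply, rightCre_apply]; ring

lemma commute_leftAnn_leftQubit (B : QubitOp) : Commute leftAnn (leftQubit B) := by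
  ext X ⟨m, i⟩ ⟨n, j⟩
  simp only [Module.End.mul_apply, leftAnn_apply, leftQubit_apply, Finset.mul_sum]
  exact Finset.sum_congr rfl fun s _ => by ring

lemma commute_leftAnn_rightQubit (B : QubitOp) : Commute leftAnn (rightQubit B) := by
  ext X ⟨m, i⟩ ⟨n, j⟩
  simp only [Module.End.mul_apply, leftAnn_apply, rightQubit_apply, Finset.mul_sum]
  exact Finset.sum_congr rfl fun s _ => by ring

lemma commute_rightCre_leftQubit (B : QubitOp) : Commute rightCre (leftQubit B) := by
  ext X ⟨m, i⟩ ⟨n, j⟩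
  simp only [Module.End.mul_apply, rightCre_apply, leftQubit_apply, Finset.mul_sum]
  exact Finset.sum_congr rfl fun s _ => by ring

lemma commute_rightCre_rightQubit (B : QubitOp) : Commute rightCre (rightQubit B) := by
  ext X ⟨m, i⟩ ⟨n, j⟩
  simp only [Module.End.mul_apply, rightCre_apply, rightQubit_apply, Finset.mul_sum]
  exact Finset.sum_congr rfl fun s _ => by ring

/-- Commuting with `c` acts as the derivative on powers of `a`. This is what produces the
normal-ordering terms of the moments; at `q = 0` the factor `q` kills the truncated exponent. -/
lemma pow_mul_of_mul_eq_mul_add_one {R : Type*} [Ring R] {a c : R} (h : a * c = c * a + 1)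
    (q : ℕ) : a ^ q * c = c * a ^ q + q • a ^ (q - 1) := by
  induction q with
  | zero => simp
  | succ q ih =>
    rw [pow_succ, mul_assoc, h, mul_add, ← mul_assoc, ih, add_mul, mul_assoc, ← pow_succ,
      mul_one, Nat.add_sub_cancel, add_assoc]
    congr 1
    rcases q with _ | q
    · simp
    · rw [Nat.add_sub_cancel, smul_mul_assoc, ← pow_succ, ← succ_nsmul]

/-! ### Rapidly decreasing operators -/

lemma RapidlyDecreasing.zero : RapidlyDecreasing 0 := fun _ => ⟨0, by simp⟩

lemma RapidlyDecreasing.add {X Y : TotalOp} (hX : RapidlyDecreasing X) (hY : RapidlyDecreasing Y) :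
    RapidlyDecreasing (X + Y) := by
  intro p
  obtain ⟨C, hC⟩ := hX p
  obtain ⟨D, hD⟩ := hY p
  refine ⟨C + D, fun m n i j => ?_⟩
  calc ((m : ℝ) + n + 1) ^ p * ‖(X + Y) (m, i) (n, j)‖
      ≤ ((m : ℝ) + n + 1) ^ p * (‖X (m, i) (n, j)‖ + ‖Y (m, i) (n, j)‖) := by
        gcongr; exact norm_add_le _ _
    _ ≤ C + D := by rw [mul_add]; exact add_le_add (hC m n i j) (hD m n i j)

lemma RapidlyDecreasing.smul {X : TotalOp} (c : ℂ) (hX : RapidlyDecreasing X) :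
    RapidlyDecreasing (c • X) := by
  intro p
  obtain ⟨C, hC⟩ := hX p
  refine ⟨‖c‖ * C, fun m n i j => ?_⟩
  rw [Matrix.smul_apply, norm_smul, mul_left_comm]
  exact mul_le_mul_of_nonneg_left (hC m n i j) (norm_nonneg c)

lemma RapidlyDecreasing.sub {X Y : TotalOp} (hX : RapidlyDecreasing X) (hY : RapidlyDecreasing Y) :
    RapidlyDecreasing (X - Y) := by
  rw [sub_eq_add_neg, ← neg_one_smul ℂ Y]
  exact hX.add (hY.smul _)

lemma RapidlyDecreasing.sum {ι : Type*} (s : Finset ι) {X : ι → TotalOp}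
    (hX : ∀ k ∈ s, RapidlyDecreasing (X k)) : RapidlyDecreasing (∑ k ∈ s, X k) := by
  classical
  induction s using Finset.induction_on with
  | empty => simpa using RapidlyDecreasing.zero
  | insert a s ha ih =>
    rw [Finset.sum_insert ha]
    exact (hX a (by simp)).add (ih fun k hk => hX k (by simp [hk]))

lemma RapidlyDecreasing.transpose {X : TotalOp} (hX : RapidlyDecreasing X) :
    RapidlyDecreasing Xᵀ := by
  intro p
  obtain ⟨C, hC⟩ := hX p
  refine ⟨C, fun m n i j => ?_⟩
  rw [Matrix.transpose_apply, add_comm (m : ℝ)]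
  exact hC n m j i

lemma sqrt_natCast_le_of_le {m : ℕ} {x : ℝ} (h : (m : ℝ) ≤ x) (hx : 1 ≤ x) : √(m : ℝ) ≤ x := by
  rw [Real.sqrt_le_left (by linarith)]
  nlinarith

lemma RapidlyDecreasing.leftAnn {X : TotalOp} (hX : RapidlyDecreasing X) :
    RapidlyDecreasing (leftAnn X) := by
  intro p
  -- The additional power of the weight absorbs the factor `√(m + 1)`.
  obtain ⟨C, hC⟩ := hX (p + 1)
  refine ⟨C, fun m n i j => (le_trans ?_ (hC (m + 1) n i j))⟩
  rw [leftAnn_apply, norm_mul, Complex.norm_real, Real.norm_of_nonneg (Real.sqrt_nonneg _),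
    ← mul_assoc, pow_succ]
  have h : √((m + 1 : ℕ) : ℝ) ≤ ((m + 1 : ℕ) : ℝ) + n + 1 := by
    apply sqrt_natCast_le_of_le
    · linarith [Nat.cast_nonneg (α := ℝ) n]
    · linarith [Nat.cast_nonneg (α := ℝ) n, Nat.cast_nonneg (α := ℝ) m]
  gcongr
  linarith

lemma RapidlyDecreasing.leftCre {X : TotalOp} (hX : RapidlyDecreasing X) :
    RapidlyDecreasing (leftCre X) := by
  intro p
  obtain ⟨C, hC⟩ := hX (p + 1)
  have hC0 : 0 ≤ C := le_trans (by positivity) (hC 0 0 0 0)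
  -- Lowering the index shrinks the weight, and `m + n + 2 ≤ 2 (m + n + 1)` costs the factor `2 ^
  -- p`.
  refine ⟨2 ^ p * C, fun m n i j => ?_⟩
  rw [leftCre_apply]
  rcases m with _ | m
  · simpa using hC0
  refine le_trans ?_ (mul_le_mul_of_nonneg_left (hC m n i j) (by positivity))
  rw [norm_mul, Complex.norm_real, Real.norm_of_nonneg (Real.sqrt_nonneg _), Nat.add_sub_cancel,
    ← mul_assoc, ← mul_assoc, pow_succ, ← mul_assoc, ← mul_pow]
  have h : √((m + 1 : ℕ) : ℝ) ≤ (m : ℝ) + n + 1 := by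
    apply sqrt_natCast_le_of_le
    · push_cast; linarith [Nat.cast_nonneg (α := ℝ) n]
    · linarith [Nat.cast_nonneg (α := ℝ) n, Nat.cast_nonneg (α := ℝ) m]
  gcongr
  push_cast
  linarith [Nat.cast_nonneg (α := ℝ) n, Nat.cast_nonneg (α := ℝ) m]

lemma RapidlyDecreasing.rightCre {X : TotalOp} (hX : RapidlyDecreasing X) :
    RapidlyDecreasing (rightCre X) :=
  hX.transpose.leftAnn.transpose

lemma RapidlyDecreasing.rightAnn {X : TotalOp} (hX : RapidlyDecreasing X) :
    RapidlyDecreasing (rightAnn X) :=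
  hX.transpose.leftCre.transpose

lemma RapidlyDecreasing.leftQubit {X : TotalOp} (B : QubitOp) (hX : RapidlyDecreasing X) :
    RapidlyDecreasing (leftQubit B X) := by
  intro p
  obtain ⟨C, hC⟩ := hX p
  refine ⟨∑ i, ∑ s, ‖B i s‖ * C, fun m n i j => ?_⟩
  have hC0 : 0 ≤ C := le_trans (by positivity) (hC 0 0 0 0)
  calc ((m : ℝ) + n + 1) ^ p * ‖JaynesCummings.leftQubit B X (m, i) (n, j)‖
      ≤ ((m : ℝ) + n + 1) ^ p * ∑ s, ‖B i s * X (m, s) (n, j)‖ := by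
        rw [leftQubit_apply]; gcongr; exact norm_sum_le _ _
    _ = ∑ s, ‖B i s‖ * (((m : ℝ) + n + 1) ^ p * ‖X (m, s) (n, j)‖) := by
        rw [Finset.mul_sum]
        exact Finset.sum_congr rfl fun s _ => by rw [norm_mul]; ring
    _ ≤ ∑ s, ‖B i s‖ * C := by gcongr with s; exact hC m n s j
    _ ≤ ∑ i, ∑ s, ‖B i s‖ * C :=
        Finset.single_le_sum (f := fun i => ∑ s, ‖B i s‖ * C)
          (fun i _ => Finset.sum_nonneg fun s _ => by positivity) (Finset.mem_univ i)

lemma RapidlyDecreasing.rightQubit {X : TotalOp} (B : QubitOp) (hX : RapidlyDecreasing X) :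
    RapidlyDecreasing (rightQubit B X) := by
  have h : JaynesCummings.rightQubit B X = (JaynesCummings.leftQubit Bᵀ Xᵀ)ᵀ := by
    ext ⟨m, i⟩ ⟨n, j⟩
    simp [leftQubit_apply, rightQubit_apply, mul_comm]
  rw [h]
  exact (hX.transpose.leftQubit Bᵀ).transpose

lemma RapidlyDecreasing.summable {X : TotalOp} (hX : RapidlyDecreasing X) (i j : Fin 2) :
    Summable fun m : ℕ => X (m, i) (m, j) := by
  obtain ⟨C, hC⟩ := hX 2
  have hs : Summable fun m : ℕ => C * (1 / ((m + 1 : ℕ) : ℝ) ^ 2) :=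
    ((summable_nat_add_iff 1).2 (Real.summable_one_div_nat_pow.2 one_lt_two)).mul_left C
  refine Summable.of_norm_bounded hs fun m => ?_
  rw [mul_one_div, le_div_iff₀ (by positivity), mul_comm]
  refine le_trans ?_ (hC m m i j)
  gcongr
  push_cast
  linarith [Nat.cast_nonneg (α := ℝ) m]

/-! ### Partial traces -/

lemma traceA_apply (X : TotalOp) (i j : Fin 2) : traceA X i j = ∑' m : ℕ, X (m, i) (m, j) := rfl

lemma traceA_zero : traceA 0 = 0 := by ext; simp [traceA_apply]

lemma traceA_add {X Y : TotalOp} (hX : RapidlyDecreasing X) (hY : RapidlyDecreasing Y) :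
    traceA (X + Y) = traceA X + traceA Y := by
  ext i j
  exact (hX.summable i j).tsum_add (hY.summable i j)

lemma traceA_smul (c : ℂ) (X : TotalOp) : traceA (c • X) = c • traceA X := by
  ext i j
  exact tsum_mul_left

/-- Cyclicity of the trace: the two series differ by an index shift, and the extra zeroth term
carries `√0`. -/
lemma traceA_leftAnn {X : TotalOp} (hX : RapidlyDecreasing X) :
    traceA (leftAnn X) = traceA (rightAnn X) := by
  ext i j
  rw [traceA_apply, traceA_apply, (hX.rightAnn.summable i j).tsum_eq_zero_add]
  simp [leftAnn_apply, rightAnn_apply]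

lemma traceA_leftCre {X : TotalOp} (hX : RapidlyDecreasing X) :
    traceA (leftCre X) = traceA (rightCre X) := by
  ext i j
  rw [traceA_apply, traceA_apply, (hX.leftCre.summable i j).tsum_eq_zero_add]
  simp [leftCre_apply, rightCre_apply]

lemma traceA_leftQubit {X : TotalOp} (B : QubitOp) (hX : RapidlyDecreasing X) :
    traceA (leftQubit B X) = B * traceA X := by
  ext i j
  simp only [traceA_apply, leftQubit_apply, Matrix.mul_apply]
  rw [Summable.tsum_finsetSum fun s _ => (hX.summable s j).mul_left _]
  exact Finset.sum_congr rfl fun s _ => tsum_mul_left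

lemma traceA_rightQubit {X : TotalOp} (B : QubitOp) (hX : RapidlyDecreasing X) :
    traceA (rightQubit B X) = traceA X * B := by
  ext i j
  simp only [traceA_apply, rightQubit_apply, Matrix.mul_apply]
  rw [Summable.tsum_finsetSum fun s _ => (hX.summable i s).mul_right _]
  exact Finset.sum_congr rfl fun s _ => tsum_mul_right

/-! ### Moments -/

/-- The partial trace of `a ^ q X (a†) ^ p` over the oscillator. -/
def moment (p q : ℕ) (X : TotalOp) : QubitOp := traceA ((rightCre ^ p * leftAnn ^ q) X)

lemma moment_zero_zero (X : TotalOp) : moment 0 0 X = traceA X := by simp [moment]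

lemma RapidlyDecreasing.pow_leftAnn {X : TotalOp} (hX : RapidlyDecreasing X) (q : ℕ) :
    RapidlyDecreasing ((JaynesCummings.leftAnn ^ q) X) := by
  induction q with
  | zero => simpa using hX
  | succ q ih => rw [pow_succ']; exact ih.leftAnn

lemma RapidlyDecreasing.pow_rightCre {X : TotalOp} (hX : RapidlyDecreasing X) (p : ℕ) :
    RapidlyDecreasing ((JaynesCummings.rightCre ^ p) X) := by
  induction p with
  | zero => simpa using hX
  | succ p ih => rw [pow_succ']; exact ih.rightCre

lemma RapidlyDecreasing.rightCre_pow_mul_leftAnn_pow {X : TotalOp} (hX : RapidlyDecreasing X)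
    (p q : ℕ) :
    RapidlyDecreasing ((JaynesCummings.rightCre ^ p * JaynesCummings.leftAnn ^ q) X) :=
  (hX.pow_leftAnn q).pow_rightCre p

lemma moment_zero (p q : ℕ) : moment p q 0 = 0 := by simp [moment, traceA_zero]

lemma moment_smul (p q : ℕ) (c : ℂ) (X : TotalOp) : moment p q (c • X) = c • moment p q X := by
  simp [moment, traceA_smul]

lemma moment_add (p q : ℕ) {X Y : TotalOp} (hX : RapidlyDecreasing X) (hY : RapidlyDecreasing Y) :
    moment p q (X + Y) = moment p q X + moment p q Y := by
  rw [moment, map_add, traceA_add (hX.rightCre_pow_mul_leftAnn_pow p q)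
    (hY.rightCre_pow_mul_leftAnn_pow p q), moment, moment]

lemma moment_sub (p q : ℕ) {X Y : TotalOp} (hX : RapidlyDecreasing X) (hY : RapidlyDecreasing Y) :
    moment p q (X - Y) = moment p q X - moment p q Y := by
  rw [sub_eq_add_neg, ← neg_one_smul ℂ Y, moment_add p q hX (hY.smul _), moment_smul,
    neg_one_smul, sub_eq_add_neg]

lemma moment_sum (p q : ℕ) {ι : Type*} (s : Finset ι) {X : ι → TotalOp}
    (hX : ∀ k ∈ s, RapidlyDecreasing (X k)) :
    moment p q (∑ k ∈ s, X k) = ∑ k ∈ s, moment p q (X k) := by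
  classical
  induction s using Finset.induction_on with
  | empty => simp [moment_zero]
  | insert a s ha ih =>
    have hs : ∀ k ∈ s, RapidlyDecreasing (X k) := fun k hk => hX k (by simp [hk])
    rw [Finset.sum_insert ha, Finset.sum_insert ha,
      moment_add p q (hX a (by simp)) (RapidlyDecreasing.sum s hs), ih hs]

lemma moment_leftAnn (p q : ℕ) (X : TotalOp) : moment p q (leftAnn X) = moment p (q + 1) X := by
  rw [moment, moment, ← Module.End.mul_apply, mul_assoc, ← pow_succ]

lemma moment_rightCre (p q : ℕ) (X : TotalOp) :
    moment p q (rightCre X) = moment (p + 1) q X := by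
  rw [moment, moment, ← Module.End.mul_apply, mul_assoc,
    (commute_leftAnn_rightCre.pow_left q).eq, ← mul_assoc, ← pow_succ]

/-- Normal ordering gives `a ^ q a† = a† a ^ q + q a ^ (q - 1)`; cyclicity then moves the leading
`a†` to the right end, where it raises `p`. -/
lemma moment_leftCre (p q : ℕ) {X : TotalOp} (hX : RapidlyDecreasing X) :
    moment p q (leftCre X) = moment (p + 1) q X + (q : ℂ) • moment p (q - 1) X := by
  have h : rightCre ^ p * leftAnn ^ q * leftCre
      = leftCre * (rightCre ^ p * leftAnn ^ q) + (q : ℂ) • (rightCre ^ p * leftAnn ^ (q - 1)) := by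
    rw [mul_assoc, pow_mul_of_mul_eq_mul_add_one leftAnn_mul_leftCre, mul_add, ← mul_assoc,
      (commute_leftCre_rightCre.pow_right p).eq.symm, mul_assoc, Nat.cast_smul_eq_nsmul,
      mul_smul_comm]
  rw [moment, ← Module.End.mul_apply, h, LinearMap.add_apply, LinearMap.smul_apply,
    Module.End.mul_apply leftCre, traceA_add (hX.rightCre_pow_mul_leftAnn_pow p q).leftCre
      ((hX.rightCre_pow_mul_leftAnn_pow p (q - 1)).smul _), traceA_smul,
    traceA_leftCre (hX.rightCre_pow_mul_leftAnn_pow p q), ← Module.End.mul_apply, ← mul_assoc,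
    ← pow_succ', moment, moment]

lemma moment_rightAnn (p q : ℕ) {X : TotalOp} (hX : RapidlyDecreasing X) :
    moment p q (rightAnn X) = moment p (q + 1) X + (p : ℂ) • moment (p - 1) q X := by
  have h : rightCre ^ p * leftAnn ^ q * rightAnn
      = rightAnn * (rightCre ^ p * leftAnn ^ q) + (p : ℂ) • (rightCre ^ (p - 1) * leftAnn ^ q) := by
    rw [mul_assoc, (commute_leftAnn_rightAnn.pow_left q).eq, ← mul_assoc,
      pow_mul_of_mul_eq_mul_add_one rightCre_mul_rightAnn, add_mul, mul_assoc,
      Nat.cast_smul_eq_nsmul, smul_mul_assoc]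
  rw [moment, ← Module.End.mul_apply, h, LinearMap.add_apply, LinearMap.smul_apply,
    Module.End.mul_apply rightAnn, traceA_add (hX.rightCre_pow_mul_leftAnn_pow p q).rightAnn
      ((hX.rightCre_pow_mul_leftAnn_pow (p - 1) q).smul _), traceA_smul,
    ← traceA_leftAnn (hX.rightCre_pow_mul_leftAnn_pow p q), ← Module.End.mul_apply, ← mul_assoc,
    (commute_leftAnn_rightCre.pow_right p).eq, mul_assoc, ← pow_succ', moment, moment]

lemma moment_leftQubit (p q : ℕ) (B : QubitOp) {X : TotalOp} (hX : RapidlyDecreasing X) :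
    moment p q (leftQubit B X) = B * moment p q X := by
  rw [moment, ← Module.End.mul_apply,
    ((commute_rightCre_leftQubit B).pow_left p).mul_left
      ((commute_leftAnn_leftQubit B).pow_left q) |>.eq, Module.End.mul_apply,
    traceA_leftQubit B (hX.rightCre_pow_mul_leftAnn_pow p q), moment]

lemma moment_rightQubit (p q : ℕ) (B : QubitOp) {X : TotalOp} (hX : RapidlyDecreasing X) :
    moment p q (rightQubit B X) = moment p q X * B := by
  rw [moment, ← Module.End.mul_apply,
    ((commute_rightCre_rightQubit B).pow_left p).mul_left
      ((commute_leftAnn_rightQubit B).pow_left q) |>.eq, Module.End.mul_apply,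
    traceA_rightQubit B (hX.rightCre_pow_mul_leftAnn_pow p q), moment]

/-! ### Products of infinite matrices with ladder operators -/

lemma annihilation_apply_of_ne {m k : ℕ} (h : k ≠ m + 1) : annihilation m k = 0 := if_neg h

lemma annihilation_apply_succ (m : ℕ) : annihilation m (m + 1) = ((√(m + 1 : ℕ) : ℝ) : ℂ) :=
  if_pos rfl

lemma creation_apply (m k : ℕ) : creation m k = star (annihilation k m) := rfl

lemma creation_apply_of_ne {m k : ℕ} (h : m ≠ k + 1) : creation m k = 0 := by
  rw [creation_apply, annihilation_apply_of_ne h, star_zero]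

lemma creation_succ_apply (m : ℕ) : creation (m + 1) m = ((√(m + 1 : ℕ) : ℝ) : ℂ) := by
  rw [creation_apply, annihilation_apply_succ, Complex.star_def, Complex.conj_ofReal]

lemma creation_apply_pred (m : ℕ) : creation m (m - 1) = ((√(m : ℕ) : ℝ) : ℂ) := by
  rcases m with _ | m
  · rw [creation_apply_of_ne (by simp)]; simp
  · exact creation_succ_apply m

lemma annihilation_pred_apply (m : ℕ) : annihilation (m - 1) m = ((√(m : ℕ) : ℝ) : ℂ) := by
  rcases m with _ | m
  · rw [annihilation_apply_of_ne (by simp)]; simp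
  · exact annihilation_apply_succ m

lemma conjTranspose_annihilation : annihilationᴴ = creation := rfl

lemma conjTranspose_creation : creationᴴ = annihilation := Matrix.conjTranspose_conjTranspose _

/-- Row `m` of `A` is supported in the single column `m'`, so the infinite sum collapses to a sum
over the qubit index. This covers ladder and diagonal matrices alike. -/
lemma hasSum_kronecker_mul (A : Matrix ℕ ℕ ℂ) (B : QubitOp) (X : TotalOp) {m m' : ℕ} (i : Fin 2)
    (y : ℕ × Fin 2) (h : ∀ k, k ≠ m' → A m k = 0) :
    HasSum (fun k => (A ⊗ₖ B) (m, i) k * X k y) (A m m' * ∑ s, B i s * X (m', s) y) := by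
  have := hasSum_sum_of_ne_finset_zero (s := ({m'} : Finset ℕ) ×ˢ (Finset.univ : Finset (Fin 2)))
    (f := fun k => (A ⊗ₖ B) (m, i) k * X k y) (L := SummationFilter.unconditional _) (by
      rintro ⟨k, s⟩ hk
      have hk' : k ≠ m' := fun e => hk (by simp [e])
      simp [h k hk'])
  rw [Finset.sum_product, Finset.sum_singleton] at this
  convert this using 1
  rw [Finset.mul_sum]
  exact Finset.sum_congr rfl fun s _ => by simp [mul_assoc]

lemma hasSum_mul_kronecker (A : Matrix ℕ ℕ ℂ) (B : QubitOp) (X : TotalOp) {n n' : ℕ}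
    (x : ℕ × Fin 2) (j : Fin 2) (h : ∀ k, k ≠ n' → A k n = 0) :
    HasSum (fun k => X x k * (A ⊗ₖ B) k (n, j)) (A n' n * ∑ s, X x (n', s) * B s j) := by
  have := hasSum_sum_of_ne_finset_zero (s := ({n'} : Finset ℕ) ×ˢ (Finset.univ : Finset (Fin 2)))
    (f := fun k => X x k * (A ⊗ₖ B) k (n, j)) (L := SummationFilter.unconditional _) (by
      rintro ⟨k, s⟩ hk
      have hk' : k ≠ n' := fun e => hk (by simp [e])
      simp [h k hk'])
  rw [Finset.sum_product, Finset.sum_singleton] at this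
  convert this using 1
  rw [Finset.mul_sum]
  exact Finset.sum_congr rfl fun s _ => by simp [mul_left_comm]

lemma hasSum_annihilation_kronecker_mul (B : QubitOp) (X : TotalOp) (x y : ℕ × Fin 2) :
    HasSum (fun k => (annihilation ⊗ₖ B) x k * X k y) (leftAnn (leftQubit B X) x y) := by
  obtain ⟨m, i⟩ := x
  rw [leftAnn_apply, leftQubit_apply, ← annihilation_apply_succ]
  exact hasSum_kronecker_mul _ B X i y fun k hk => annihilation_apply_of_ne hk

lemma hasSum_creation_kronecker_mul (B : QubitOp) (X : TotalOp) (x y : ℕ × Fin 2) :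
    HasSum (fun k => (creation ⊗ₖ B) x k * X k y) (leftCre (leftQubit B X) x y) := by
  obtain ⟨m, i⟩ := x
  rw [leftCre_apply, leftQubit_apply, ← creation_apply_pred]
  exact hasSum_kronecker_mul _ B X i y fun k hk => creation_apply_of_ne (by omega)

lemma hasSum_mul_annihilation_kronecker (B : QubitOp) (X : TotalOp) (x y : ℕ × Fin 2) :
    HasSum (fun k => X x k * (annihilation ⊗ₖ B) k y) (rightAnn (rightQubit B X) x y) := by
  obtain ⟨n, j⟩ := y
  rw [rightAnn_apply, rightQubit_apply, ← annihilation_pred_apply]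
  exact hasSum_mul_kronecker _ B X x j fun k hk => annihilation_apply_of_ne (by omega)

lemma hasSum_mul_creation_kronecker (B : QubitOp) (X : TotalOp) (x y : ℕ × Fin 2) :
    HasSum (fun k => X x k * (creation ⊗ₖ B) k y) (rightCre (rightQubit B X) x y) := by
  obtain ⟨n, j⟩ := y
  rw [rightCre_apply, rightQubit_apply, ← creation_succ_apply]
  exact hasSum_mul_kronecker _ B X x j fun k hk => creation_apply_of_ne (by omega)

lemma leftQubit_one : leftQubit 1 = 1 := by
  ext X ⟨m, i⟩ y
  simp [leftQubit_apply, Matrix.one_apply]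

lemma rightQubit_one : rightQubit 1 = 1 := by
  ext X x ⟨n, j⟩
  simp [rightQubit_apply, Matrix.one_apply]

lemma infMul_annihilation_left (X : TotalOp) :
    infMul (annihilation ⊗ₖ (1 : QubitOp)) X = leftAnn X := by
  ext x y
  have := (hasSum_annihilation_kronecker_mul 1 X x y).tsum_eq
  rw [leftQubit_one] at this
  exact this

lemma infMul_creation_left (X : TotalOp) :
    infMul (creation ⊗ₖ (1 : QubitOp)) X = leftCre X := by
  ext x y
  have := (hasSum_creation_kronecker_mul 1 X x y).tsum_eq
  rw [leftQubit_one] at this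
  exact this

lemma infMul_annihilation_right (X : TotalOp) :
    infMul X (annihilation ⊗ₖ (1 : QubitOp)) = rightAnn X := by
  ext x y
  have := (hasSum_mul_annihilation_kronecker 1 X x y).tsum_eq
  rw [rightQubit_one] at this
  exact this

lemma infMul_creation_right (X : TotalOp) :
    infMul X (creation ⊗ₖ (1 : QubitOp)) = rightCre X := by
  ext x y
  have := (hasSum_mul_creation_kronecker 1 X x y).tsum_eq
  rw [rightQubit_one] at this
  exact this

lemma infMul_diagonal_left (d : ℕ → ℂ) (X : TotalOp) (m : ℕ) (i : Fin 2) (y : ℕ × Fin 2) :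
    infMul (Matrix.diagonal d ⊗ₖ (1 : QubitOp)) X (m, i) y = d m * X (m, i) y := by
  have : infMul (Matrix.diagonal d ⊗ₖ (1 : QubitOp)) X (m, i) y = _ :=
    (hasSum_kronecker_mul (m := m) (m' := m) (Matrix.diagonal d) 1 X i y
    fun k hk => Matrix.diagonal_apply_ne' d hk).tsum_eq
  rw [this]
  simp [Matrix.one_apply]

lemma infMul_diagonal_right (d : ℕ → ℂ) (X : TotalOp) (x : ℕ × Fin 2) (n : ℕ) (j : Fin 2) :
    infMul X (Matrix.diagonal d ⊗ₖ (1 : QubitOp)) x (n, j) = d n * X x (n, j) := by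
  have : infMul X (Matrix.diagonal d ⊗ₖ (1 : QubitOp)) x (n, j) = _ :=
    (hasSum_mul_kronecker (n := n) (n' := n) (Matrix.diagonal d) 1 X x j
    fun k hk => Matrix.diagonal_apply_ne d hk).tsum_eq
  rw [this]
  simp [Matrix.one_apply]

lemma leftCre_annihilation :
    leftCre (annihilation ⊗ₖ (1 : QubitOp)) = Matrix.diagonal (fun m : ℕ => (m : ℂ)) ⊗ₖ 1 := by
  ext ⟨m, i⟩ ⟨n, j⟩
  rw [leftCre_apply, Matrix.kronecker_apply, Matrix.kronecker_apply, ← mul_assoc]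
  congr 1
  rcases m with _ | m
  · simp [Matrix.diagonal_apply]
  · rcases eq_or_ne n (m + 1) with rfl | h
    · simp only [Nat.add_sub_cancel, annihilation_apply_succ, ofReal_sqrt_natCast_mul_self,
        Matrix.diagonal_apply_eq]
    · rw [Nat.add_sub_cancel, annihilation_apply_of_ne h, mul_zero,
        Matrix.diagonal_apply_ne' _ h]

lemma leftAnn_creation :
    leftAnn (creation ⊗ₖ (1 : QubitOp))
      = Matrix.diagonal (fun m : ℕ => ((m + 1 : ℕ) : ℂ)) ⊗ₖ 1 := by
  ext ⟨m, i⟩ ⟨n, j⟩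
  rw [leftAnn_apply, Matrix.kronecker_apply, Matrix.kronecker_apply, ← mul_assoc]
  congr 1
  rcases eq_or_ne n m with rfl | h
  · simp only [creation_succ_apply, ofReal_sqrt_natCast_mul_self, Matrix.diagonal_apply_eq]
  · rw [creation_apply_of_ne (by omega), mul_zero, Matrix.diagonal_apply_ne' _ h]

lemma infMul_creation_annihilation :
    infMul creation annihilation = Matrix.diagonal fun m : ℕ => (m : ℂ) := by
  ext m n
  rw [infMul, Matrix.of_apply, tsum_eq_single (m - 1) fun k hk => by
    rw [creation_apply_of_ne (by omega), zero_mul], creation_apply_pred]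
  -- The qubit entry `(0, 0)` of the tensored identity is the oscillator identity.
  have h := congrFun (congrFun leftCre_annihilation (m, 0)) (n, 0)
  rw [leftCre_apply, Matrix.kronecker_apply, Matrix.kronecker_apply] at h
  simpa using h

lemma diagonal_left_eq (X : TotalOp) :
    infMul (Matrix.diagonal (fun m : ℕ => (m : ℂ)) ⊗ₖ (1 : QubitOp)) X = leftCre (leftAnn X) := by
  ext ⟨m, i⟩ y
  rw [infMul_diagonal_left, leftCre_leftAnn_apply]

lemma diagonal_right_eq (X : TotalOp) :
    infMul X (Matrix.diagonal (fun m : ℕ => (m : ℂ)) ⊗ₖ (1 : QubitOp))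
      = rightAnn (rightCre X) := by
  ext x ⟨n, j⟩
  rw [infMul_diagonal_right, rightAnn_rightCre_apply]

lemma diagonal_succ_left_eq (X : TotalOp) :
    infMul (Matrix.diagonal (fun m : ℕ => ((m + 1 : ℕ) : ℂ)) ⊗ₖ (1 : QubitOp)) X
      = leftAnn (leftCre X) := by
  ext ⟨m, i⟩ y
  rw [infMul_diagonal_left, leftAnn_leftCre_apply]

lemma diagonal_succ_right_eq (X : TotalOp) :
    infMul X (Matrix.diagonal (fun m : ℕ => ((m + 1 : ℕ) : ℂ)) ⊗ₖ (1 : QubitOp))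
      = rightCre (rightAnn X) := by
  ext x ⟨n, j⟩
  rw [infMul_diagonal_right, rightCre_rightAnn_apply]

/-! ### The generators in terms of ladder superoperators -/

lemma totalDissipator_annihilation (X : TotalOp) :
    totalDissipator (annihilation ⊗ₖ (1 : QubitOp)) X
      = rightCre (leftAnn X) - (1 / 2 : ℂ) • (leftCre (leftAnn X) + rightAnn (rightCre X)) := by
  rw [totalDissipator, Matrix.conjTranspose_kronecker, Matrix.conjTranspose_one,
    conjTranspose_annihilation, infMul_annihilation_left, infMul_creation_right,
    infMul_creation_left, leftCre_annihilation, diagonal_left_eq, diagonal_right_eq]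

lemma totalDissipator_creation (X : TotalOp) :
    totalDissipator (creation ⊗ₖ (1 : QubitOp)) X
      = rightAnn (leftCre X) - (1 / 2 : ℂ) • (leftAnn (leftCre X) + rightCre (rightAnn X)) := by
  rw [totalDissipator, Matrix.conjTranspose_kronecker, Matrix.conjTranspose_one,
    conjTranspose_creation, infMul_creation_left, infMul_annihilation_right,
    infMul_annihilation_left, leftAnn_creation, diagonal_succ_left_eq, diagonal_succ_right_eq]

lemma fastGenerator_eq (Δ γ nth : ℝ) (X : TotalOp) :
    fastGenerator Δ γ nth X
      = (-Complex.I * Δ) • (leftCre (leftAnn X) - rightAnn (rightCre X))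
        + ((γ * (1 + nth) : ℝ) : ℂ) •
          (rightCre (leftAnn X) - (1 / 2 : ℂ) • (leftCre (leftAnn X) + rightAnn (rightCre X)))
        + ((γ * nth : ℝ) : ℂ) •
          (rightAnn (leftCre X) - (1 / 2 : ℂ) • (leftAnn (leftCre X) + rightCre (rightAnn X))) := by
  rw [fastGenerator, totalDissipator_annihilation, totalDissipator_creation, totalCommutator,
    infMul_creation_annihilation, diagonal_left_eq, diagonal_right_eq]

lemma interaction_eq (g : ℝ) (X : TotalOp) :
    interaction g X = (-Complex.I * g) •
      (leftCre (leftQubit sigmaMinus X) + leftAnn (leftQubit sigmaPlus X)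
        - (rightCre (rightQubit sigmaMinus X) + rightAnn (rightQubit sigmaPlus X))) := by
  have h1 : infMul (creation ⊗ₖ sigmaMinus + annihilation ⊗ₖ sigmaPlus) X
      = leftCre (leftQubit sigmaMinus X) + leftAnn (leftQubit sigmaPlus X) := by
    ext x y
    simp only [infMul, Matrix.of_apply, Matrix.add_apply, add_mul]
    exact ((hasSum_creation_kronecker_mul _ X x y).add
      (hasSum_annihilation_kronecker_mul _ X x y)).tsum_eq
  have h2 : infMul X (creation ⊗ₖ sigmaMinus + annihilation ⊗ₖ sigmaPlus)
      = rightCre (rightQubit sigmaMinus X) + rightAnn (rightQubit sigmaPlus X) := by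
    ext x y
    simp only [infMul, Matrix.of_apply, Matrix.add_apply, mul_add]
    exact ((hasSum_mul_creation_kronecker _ X x y).add
      (hasSum_mul_annihilation_kronecker _ X x y)).tsum_eq
  rw [interaction, totalCommutator, h1, h2]

/-! ### Moments of the generators -/

/-- The decay rate of the moment of order `(p, q)`. -/
def momentRate (Δ γ : ℝ) (p q : ℕ) : ℂ := (p + q) * (γ / 2) - Complex.I * (p - q) * Δ

lemma RapidlyDecreasing.fastGenerator {X : TotalOp} (Δ γ nth : ℝ) (hX : RapidlyDecreasing X) :
    RapidlyDecreasing (fastGenerator Δ γ nth X) := by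
  rw [fastGenerator_eq]
  exact (((hX.leftAnn.leftCre.sub hX.rightCre.rightAnn).smul _).add
    ((hX.leftAnn.rightCre.sub ((hX.leftAnn.leftCre.add hX.rightCre.rightAnn).smul _)).smul _)).add
    ((hX.leftCre.rightAnn.sub ((hX.leftCre.leftAnn.add hX.rightAnn.rightCre).smul _)).smul _)

lemma RapidlyDecreasing.interaction {X : TotalOp} (g : ℝ) (hX : RapidlyDecreasing X) :
    RapidlyDecreasing (interaction g X) := by
  rw [interaction_eq]
  exact (((hX.leftQubit _).leftCre.add (hX.leftQubit _).leftAnn).sub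
    ((hX.rightQubit _).rightCre.add (hX.rightQubit _).rightAnn)).smul _

/-- Each of the six products of ladder operators contributes the moment `(p + 1, q + 1)` with
coefficient one, and these cancel within the commutator and within each dissipator. What remains are
the normal-ordering terms, so the moments close downwards. -/
lemma moment_fastGenerator (Δ γ nth : ℝ) (p q : ℕ) {X : TotalOp} (hX : RapidlyDecreasing X) :
    moment p q (fastGenerator Δ γ nth X)
      = -momentRate Δ γ p q • moment p q X
        + (γ * nth * p * q : ℂ) • moment (p - 1) (q - 1) X := by
  have hq : (q : ℂ) • moment p (q - 1 + 1) X = (q : ℂ) • moment p q X := by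
    rcases q with _ | q <;> simp
  have hp : (p : ℂ) • moment (p - 1 + 1) q X = (p : ℂ) • moment p q X := by
    rcases p with _ | p <;> simp
  have e1 : moment p q (leftCre (leftAnn X)) = moment (p + 1) (q + 1) X + (q : ℂ) • moment p q X := by
    rw [moment_leftCre p q hX.leftAnn, moment_leftAnn, moment_leftAnn, hq]
  have e2 : moment p q (rightAnn (rightCre X))
      = moment (p + 1) (q + 1) X + (p : ℂ) • moment p q X := by
    rw [moment_rightAnn p q hX.rightCre, moment_rightCre, moment_rightCre, hp]
  have e3 : moment p q (rightCre (leftAnn X)) = moment (p + 1) (q + 1) X := by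
    rw [moment_rightCre, moment_leftAnn]
  have e4 : moment p q (rightAnn (leftCre X)) = moment (p + 1) (q + 1) X
      + (q + 1 : ℂ) • moment p q X + (p : ℂ) • moment p q X
      + (p * q : ℂ) • moment (p - 1) (q - 1) X := by
    rw [moment_rightAnn p q hX.leftCre, moment_leftCre p (q + 1) hX, moment_leftCre (p - 1) q hX,
      smul_add, hp, smul_smul, Nat.add_sub_cancel]
    push_cast
    module
  have e5 : moment p q (leftAnn (leftCre X))
      = moment (p + 1) (q + 1) X + (q + 1 : ℂ) • moment p q X := by
    rw [moment_leftAnn, moment_leftCre p (q + 1) hX, Nat.add_sub_cancel]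
    push_cast; rfl
  have e6 : moment p q (rightCre (rightAnn X))
      = moment (p + 1) (q + 1) X + (p + 1 : ℂ) • moment p q X := by
    rw [moment_rightCre, moment_rightAnn (p + 1) q hX, Nat.add_sub_cancel]
    push_cast; rfl
  have d1 := hX.leftAnn.leftCre
  have d2 := hX.rightCre.rightAnn
  have d3 := hX.leftAnn.rightCre
  have d4 := hX.leftCre.rightAnn
  have d5 := hX.leftCre.leftAnn
  have d6 := hX.rightAnn.rightCre
  rw [fastGenerator_eq, moment_add p q (((d1.sub d2).smul _).add
      ((d3.sub ((d1.add d2).smul _)).smul _)) ((d4.sub ((d5.add d6).smul _)).smul _),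
    moment_add p q ((d1.sub d2).smul _) ((d3.sub ((d1.add d2).smul _)).smul _),
    moment_smul, moment_smul, moment_smul, moment_sub p q d1 d2,
    moment_sub p q d3 ((d1.add d2).smul _), moment_sub p q d4 ((d5.add d6).smul _),
    moment_smul, moment_smul, moment_add p q d1 d2, moment_add p q d5 d6, e1, e2, e3, e4, e5, e6,
    momentRate]
  push_cast
  module

/-- Moving `a†` from the left and `a` from the right into normal order leaves commutators with the
moments of order `p + q + 1`, plus corrections of order `p + q - 1`. -/
lemma moment_interaction (g : ℝ) (p q : ℕ) {X : TotalOp} (hX : RapidlyDecreasing X) :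
    moment p q (interaction g X) = (-Complex.I * g) •
      (sigmaMinus * moment (p + 1) q X - moment (p + 1) q X * sigmaMinus
        + (sigmaPlus * moment p (q + 1) X - moment p (q + 1) X * sigmaPlus)
        + (q : ℂ) • (sigmaMinus * moment p (q - 1) X)
        - (p : ℂ) • (moment (p - 1) q X * sigmaPlus)) := by
  have d1 := (hX.leftQubit sigmaMinus).leftCre
  have d2 := (hX.leftQubit sigmaPlus).leftAnn
  have d3 := (hX.rightQubit sigmaMinus).rightCre
  have d4 := (hX.rightQubit sigmaPlus).rightAnn
  rw [interaction_eq, moment_smul, moment_sub p q (d1.add d2) (d3.add d4), moment_add p q d1 d2,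
    moment_add p q d3 d4, moment_leftCre p q (hX.leftQubit _), moment_leftAnn, moment_rightCre,
    moment_rightAnn p q (hX.rightQubit _)]
  simp only [moment_leftQubit _ _ _ hX, moment_rightQubit _ _ _ hX]
  module

/-! ### Moments of the thermal state -/

/-- The geometric weights give `a r ^ N = r r ^ N a`, from which all thermal moments follow. -/
lemma leftAnn_thermalState (nth : ℝ) (ρ : QubitOp) :
    leftAnn (thermalState nth ⊗ₖ ρ)
      = ((nth / (1 + nth) : ℝ) : ℂ) • rightAnn (thermalState nth ⊗ₖ ρ) := by
  ext ⟨m, i⟩ ⟨n, j⟩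
  rw [Matrix.smul_apply, leftAnn_apply, rightAnn_apply, Matrix.kronecker_apply,
    Matrix.kronecker_apply, thermalState]
  rcases n with _ | n
  · simp
  · rcases eq_or_ne m n with rfl | h
    · simp
      ring
    · simp [h]

lemma rightCre_thermalState (nth : ℝ) (ρ : QubitOp) :
    rightCre (thermalState nth ⊗ₖ ρ)
      = ((nth / (1 + nth) : ℝ) : ℂ) • leftCre (thermalState nth ⊗ₖ ρ) := by
  ext ⟨m, i⟩ ⟨n, j⟩
  rw [Matrix.smul_apply, leftCre_apply, rightCre_apply, Matrix.kronecker_apply,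
    Matrix.kronecker_apply, thermalState]
  rcases m with _ | m
  · simp
  · rcases eq_or_ne m n with rfl | h
    · simp
      ring
    · simp [h]

lemma traceA_thermalState {nth : ℝ} (hnth : 0 ≤ nth) (ρ : QubitOp) :
    traceA (thermalState nth ⊗ₖ ρ) = ρ := by
  have h0 : 0 ≤ nth / (1 + nth) := by positivity
  have h1 : nth / (1 + nth) < 1 := by rw [div_lt_one (by positivity)]; linarith
  have hs : ∑' m : ℕ, (nth / (1 + nth)) ^ m ≠ 0 := by
    rw [tsum_geometric_of_lt_one h0 h1]
    exact inv_ne_zero (by linarith)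
  ext i j
  simp only [traceA_apply, Matrix.kronecker_apply, thermalState, Matrix.diagonal_apply_eq]
  rw [tsum_mul_right, ← Complex.ofReal_tsum, tsum_div_const, div_self hs, Complex.ofReal_one,
    one_mul]

/-- Exchanging `a` with the thermal state and restoring normal order gives `M = r (M + p M')` with
`r = nth / (1 + nth)`. Multiplying by `1 + nth` solves this for `M`. -/
lemma moment_thermalState_succ_right {nth : ℝ} (hnth : 0 ≤ nth) {ρ : QubitOp}
    (h : RapidlyDecreasing (thermalState nth ⊗ₖ ρ)) (p q : ℕ) :
    moment p (q + 1) (thermalState nth ⊗ₖ ρ)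
      = (nth * p : ℂ) • moment (p - 1) q (thermalState nth ⊗ₖ ρ) := by
  have hn : (1 + nth : ℂ) ≠ 0 := by exact_mod_cast (by positivity : (1 + nth : ℝ) ≠ 0)
  have h1 := moment_leftAnn p q (thermalState nth ⊗ₖ ρ)
  rw [leftAnn_thermalState, moment_smul, moment_rightAnn p q h] at h1
  have h2 := congrArg (fun Y : QubitOp => (1 + nth : ℂ) • Y) h1
  simp only [smul_smul, Complex.ofReal_div, Complex.ofReal_add, Complex.ofReal_one,
    mul_div_cancel₀ _ hn] at h2
  have h3 (Y : QubitOp) : Y = (1 + nth : ℂ) • Y - (nth : ℂ) • Y := by module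
  rw [h3 (moment p (q + 1) _), ← h2]
  module

lemma moment_thermalState_succ_left {nth : ℝ} (hnth : 0 ≤ nth) {ρ : QubitOp}
    (h : RapidlyDecreasing (thermalState nth ⊗ₖ ρ)) (p q : ℕ) :
    moment (p + 1) q (thermalState nth ⊗ₖ ρ)
      = (nth * q : ℂ) • moment p (q - 1) (thermalState nth ⊗ₖ ρ) := by
  have hn : (1 + nth : ℂ) ≠ 0 := by exact_mod_cast (by positivity : (1 + nth : ℝ) ≠ 0)
  have h1 := moment_rightCre p q (thermalState nth ⊗ₖ ρ)
  rw [rightCre_thermalState, moment_smul, moment_leftCre p q h] at h1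
  have h2 := congrArg (fun Y : QubitOp => (1 + nth : ℂ) • Y) h1
  simp only [smul_smul, Complex.ofReal_div, Complex.ofReal_add, Complex.ofReal_one,
    mul_div_cancel₀ _ hn] at h2
  have h3 (Y : QubitOp) : Y = (1 + nth : ℂ) • Y - (nth : ℂ) • Y := by module
  rw [h3 (moment (p + 1) q _), ← h2]
  module

/-! ### Moments of an adiabatic elimination -/

section Elimination

variable {Δ γ nth g : ℝ} {N : ℕ} {K : ℕ → QubitOp →ₗ[ℂ] TotalOp} {Ls : ℕ → QubitSuperop}

/-- The moment of the invariance relation. The summand with `k = n + 1` drops out because `Ls 0 =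
0`, so the right side contains only `K 0, …, K n` and a lower moment of `K (n + 1)`. -/
lemma IsPartialTraceElimination.moment_succ (E : IsPartialTraceElimination Δ γ nth g N K Ls)
    {n : ℕ} (hn : n < N) (p q : ℕ) (ρ : QubitOp) :
    momentRate Δ γ p q • moment p q (K (n + 1) ρ)
      = (γ * nth * p * q : ℂ) • moment (p - 1) (q - 1) (K (n + 1) ρ)
        + (-Complex.I * g) •
          (sigmaMinus * moment (p + 1) q (K n ρ) - moment (p + 1) q (K n ρ) * sigmaMinus
            + (sigmaPlus * moment p (q + 1) (K n ρ) - moment p (q + 1) (K n ρ) * sigmaPlus)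
            + (q : ℂ) • (sigmaMinus * moment p (q - 1) (K n ρ))
            - (p : ℂ) • (moment (p - 1) q (K n ρ) * sigmaPlus))
        - ∑ k ∈ Finset.range (n + 1), moment p q (K k (Ls (n + 1 - k) ρ)) := by
  have d1 := E.decay (n + 1) hn ρ
  have d0 := E.decay n hn.le ρ
  have h := congrArg (moment p q) (E.invariance n hn ρ)
  rw [moment_add p q (d1.fastGenerator Δ γ nth) (d0.interaction g), moment_fastGenerator _ _ _ _ _ d1,
    moment_interaction g p q d0,
    moment_sum p q _ fun k hk => E.decay k (by have := Finset.mem_range.1 hk; omega) _,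
    Finset.sum_range_succ, Nat.sub_self, E.Ls_zero, LinearMap.zero_apply, map_zero, moment_zero,
    add_zero] at h
  rw [← h]
  module

lemma IsPartialTraceElimination.Ls_succ (E : IsPartialTraceElimination Δ γ nth g N K Ls)
    (hnth : 0 ≤ nth) {n : ℕ} (hn : n < N) (ρ : QubitOp) :
    Ls (n + 1) ρ = (-Complex.I * g) •
      (sigmaMinus * moment 1 0 (K n ρ) - moment 1 0 (K n ρ) * sigmaMinus
        + (sigmaPlus * moment 0 1 (K n ρ) - moment 0 1 (K n ρ) * sigmaPlus)) := by
  have h := E.moment_succ hn 0 0 ρ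
  -- By the gauge condition only `k = 0` has a nonzero partial trace, and the thermal state has
  -- trace one.
  have hs : ∑ k ∈ Finset.range (n + 1), moment 0 0 (K k (Ls (n + 1 - k) ρ)) = Ls (n + 1) ρ := by
    rw [Finset.sum_range_succ', E.K_zero, moment_zero_zero, traceA_thermalState hnth,
      Finset.sum_eq_zero, zero_add, Nat.sub_zero]
    intro k hk
    rw [moment_zero_zero, E.gauge (k + 1) (by omega) (by have := Finset.mem_range.1 hk; omega)]
  rw [hs] at h
  simp [momentRate] at h
  rw [← sub_eq_zero, ← neg_eq_zero, h]
  simp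

/-- The moments of order zero that contribute up to fourth order. -/
lemma IsPartialTraceElimination.moment_zeroth (E : IsPartialTraceElimination Δ γ nth g N K Ls)
    (hnth : 0 ≤ nth) (ρ : QubitOp) :
    moment 0 0 (K 0 ρ) = ρ ∧ (∀ p q, p ≠ q → moment p q (K 0 ρ) = 0) ∧
      moment 1 1 (K 0 ρ) = (nth : ℂ) • ρ ∧ moment 2 2 (K 0 ρ) = (2 * nth ^ 2 : ℂ) • ρ := by
  have d := E.decay 0 (Nat.zero_le N) ρ
  rw [E.K_zero] at d ⊢
  have hr := moment_thermalState_succ_right hnth d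
  have hl := moment_thermalState_succ_left hnth d
  have h00 : moment 0 0 (thermalState nth ⊗ₖ ρ) = ρ := by
    rw [moment_zero_zero, traceA_thermalState hnth]
  refine ⟨h00, fun p => ?_, ?_, ?_⟩
  · induction p with
    | zero =>
      intro q hq
      obtain ⟨q, rfl⟩ := Nat.exists_eq_succ_of_ne_zero hq.symm
      simp [hr]
    | succ p ih =>
      intro q hq
      rcases q with _ | q
      · simp [hl]
      · rw [hr, Nat.add_sub_cancel, ih q (by omega), smul_zero]
  · simp [hr, h00]
  · simp only [hr 2 1, hr 1 0, h00, Nat.add_one_sub_one, Nat.sub_self, smul_smul]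
    push_cast
    congr 1
    ring

end Elimination

/-! ### Commutators with the ladder operators of the qubit -/

lemma sigmaPlus_eq : sigmaPlus = !![0, 1; 0, 0] := by
  ext i j
  fin_cases i <;> fin_cases j <;> norm_num [sigmaPlus, sigmaX, sigmaY, ← mul_assoc]

lemma sigmaMinus_eq : sigmaMinus = !![0, 0; 1, 0] := by
  ext i j
  fin_cases i <;> fin_cases j <;> norm_num [sigmaMinus, sigmaX, sigmaY, ← mul_assoc]

lemma sigmaMinus_mul (X : QubitOp) : sigmaMinus * X = !![0, 0; X 0 0, X 0 1] := by
  ext i j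
  fin_cases i <;> fin_cases j <;> simp [sigmaMinus_eq, Matrix.mul_apply]

lemma mul_sigmaMinus (X : QubitOp) : X * sigmaMinus = !![X 0 1, 0; X 1 1, 0] := by
  ext i j
  fin_cases i <;> fin_cases j <;> simp [sigmaMinus_eq, Matrix.mul_apply]

lemma sigmaPlus_mul (X : QubitOp) : sigmaPlus * X = !![X 1 0, X 1 1; 0, 0] := by
  ext i j
  fin_cases i <;> fin_cases j <;> simp [sigmaPlus_eq, Matrix.mul_apply]

lemma mul_sigmaPlus (X : QubitOp) : X * sigmaPlus = !![0, X 0 0; 0, X 1 0] := by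
  ext i j
  fin_cases i <;> fin_cases j <;> simp [sigmaPlus_eq, Matrix.mul_apply]

lemma reducedGenerator_apply (Δ γ nth g : ℝ) (ρ : QubitOp) :
    reducedGenerator Δ γ nth g ρ
      = !![-gammaMinus Δ γ nth g * ρ 0 0 + gammaPlus Δ γ nth g * ρ 1 1,
          (-Complex.I * omegaB Δ γ nth g - (gammaMinus Δ γ nth g + gammaPlus Δ γ nth g) / 2
            - 2 * gammaPhi Δ γ nth g) * ρ 0 1;
          (Complex.I * omegaB Δ γ nth g - (gammaMinus Δ γ nth g + gammaPlus Δ γ nth g) / 2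
            - 2 * gammaPhi Δ γ nth g) * ρ 1 0,
          gammaMinus Δ γ nth g * ρ 0 0 - gammaPlus Δ γ nth g * ρ 1 1] := by
  have hp : sigmaPlusᴴ = sigmaMinus := by
    ext i j
    fin_cases i <;> fin_cases j <;> simp [sigmaPlus_eq, sigmaMinus_eq]
  have hm : sigmaMinusᴴ = sigmaPlus := by rw [← hp, Matrix.conjTranspose_conjTranspose]
  have hzh : sigmaZᴴ = sigmaZ := by
    ext i j
    fin_cases i <;> fin_cases j <;> simp [sigmaZ]
  have hz (X : QubitOp) : sigmaZ * X = !![X 0 0, X 0 1; -X 1 0, -X 1 1] := by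
    ext i j
    fin_cases i <;> fin_cases j <;> simp [sigmaZ, Matrix.mul_apply]
  have hz' (X : QubitOp) : X * sigmaZ = !![X 0 0, -X 0 1; X 1 0, -X 1 1] := by
    ext i j
    fin_cases i <;> fin_cases j <;> simp [sigmaZ, Matrix.mul_apply]
  have hc (H : QubitOp) : qubitCommutator H ρ = H * ρ - ρ * H := rfl
  have hd (J : QubitOp) : qubitDissipator J ρ
      = J * ρ * Jᴴ - (1 / 2 : ℂ) • (Jᴴ * (J * ρ) + ρ * Jᴴ * J) := by
    simp [qubitDissipator, mul_assoc]
  simp only [reducedGenerator, LinearMap.add_apply, LinearMap.smul_apply, hc, hd, hp, hm, hzh,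
    sigmaMinus_mul, mul_sigmaMinus, sigmaPlus_mul, mul_sigmaPlus, hz, hz']
  ext i j
  fin_cases i <;> fin_cases j <;> simp <;> ring

/-! ### Solution of the moment recursion up to fourth order -/

/-- The moment equations up to fourth order; `B` and `C` stand for `γ + 2 i Δ` and its conjugate,
and `G` for `-i g`. -/
lemma fourth_order_of_moment_equations {B C γ G n : ℂ} (hB : B ≠ 0) (hC : C ≠ 0) (hγ0 : γ ≠ 0)
    (hγ : B + C = 2 * γ) {F₁ F₂ L₂ S₁ S₂ S₃ T₁ T₂ L₄ : QubitOp → QubitOp}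
    (hF₁ : ∀ ρ, (C / 2) • F₁ ρ = G • (n • (sigmaPlus * ρ) - (n + 1) • (ρ * sigmaPlus)))
    (hF₂ : ∀ ρ, (B / 2) • F₂ ρ = G • ((n + 1) • (sigmaMinus * ρ) - n • (ρ * sigmaMinus)))
    (hL₂ : ∀ ρ, L₂ ρ = G • (sigmaMinus * F₁ ρ - F₁ ρ * sigmaMinus
      + (sigmaPlus * F₂ ρ - F₂ ρ * sigmaPlus)))
    (hS₁ : ∀ ρ, C • S₁ ρ = G • ((2 * n) • (sigmaPlus * F₁ ρ) - (2 * (n + 1)) • (F₁ ρ * sigmaPlus)))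
    (hS₂ : ∀ ρ, γ • S₂ ρ = n • L₂ ρ + G • (sigmaMinus * F₁ ρ - F₂ ρ * sigmaPlus))
    (hS₃ : ∀ ρ, B • S₃ ρ
      = G • ((2 * (n + 1)) • (sigmaMinus * F₂ ρ) - (2 * n) • (F₂ ρ * sigmaMinus)))
    (hT₁ : ∀ ρ, (C / 2) • T₁ ρ = G • (sigmaMinus * S₁ ρ - S₁ ρ * sigmaMinus
      + (sigmaPlus * S₂ ρ - S₂ ρ * sigmaPlus)) - F₁ (L₂ ρ))
    (hT₂ : ∀ ρ, (B / 2) • T₂ ρ = G • (sigmaMinus * S₂ ρ - S₂ ρ * sigmaMinus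
      + (sigmaPlus * S₃ ρ - S₃ ρ * sigmaPlus)) - F₂ (L₂ ρ))
    (hL₄ : ∀ ρ, L₄ ρ = G • (sigmaMinus * T₁ ρ - T₁ ρ * sigmaMinus
      + (sigmaPlus * T₂ ρ - T₂ ρ * sigmaPlus)))
    {βm βp βm' βp' φ : ℂ}
    (hβm : βm = -2 * G ^ 2 * (n + 1) / B + 8 * G ^ 4 * (n + 1) ^ 2 / B ^ 3
      + 8 * G ^ 4 * n * (n + 1) * (1 + (B ^ 2 - C ^ 2) / (B * C)) / (C * (B * C)))
    (hβp : βp = -2 * G ^ 2 * n / B + 8 * G ^ 4 * n ^ 2 / B ^ 3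
      + 8 * G ^ 4 * n * (n + 1) * (1 + (B ^ 2 - C ^ 2) / (B * C)) / (C * (B * C)))
    (hβm' : βm' = -2 * G ^ 2 * (n + 1) / C + 8 * G ^ 4 * (n + 1) ^ 2 / C ^ 3
      + 8 * G ^ 4 * n * (n + 1) * (1 + (C ^ 2 - B ^ 2) / (B * C)) / (B * (B * C)))
    (hβp' : βp' = -2 * G ^ 2 * n / C + 8 * G ^ 4 * n ^ 2 / C ^ 3
      + 8 * G ^ 4 * n * (n + 1) * (1 + (C ^ 2 - B ^ 2) / (B * C)) / (B * (B * C)))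
    (hφ : φ = -8 * G ^ 4 * n * (n + 1) * (3 * γ ^ 4 + 6 * γ ^ 2 * ((B - C) / 2) ^ 2
      - ((B - C) / 2) ^ 4) / (γ * (B * C) ^ 3)) (ρ : QubitOp) :
    L₂ ρ + L₄ ρ = !![-(βm + βm') * ρ 0 0 + (βp + βp') * ρ 1 1, (-(βm + βp) - 2 * φ) * ρ 0 1;
      (-(βm' + βp') - 2 * φ) * ρ 1 0, (βm + βm') * ρ 0 0 - (βp + βp') * ρ 1 1] := by
  -- `F`, `S`, `T` play the roles of the moments of `K 1`, `K 2`, `K 3`, and `L₂`, `L₄` those of `Ls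
  -- 2`, `Ls 4`. Each is computed explicitly from the preceding ones.
  have hsolve {c : ℂ} (hc : c ≠ 0) {X Y : QubitOp} (h : c • X = Y) : X = c⁻¹ • Y := by
    rw [← h, smul_smul, inv_mul_cancel₀ hc, one_smul]
  have hC2 : C / 2 ≠ 0 := div_ne_zero hC two_ne_zero
  have hB2 : B / 2 ≠ 0 := div_ne_zero hB two_ne_zero
  have eF₁ (ρ) : F₁ ρ = !![2 * G / C * n * ρ 1 0, 2 * G / C * (n * ρ 1 1 - (n + 1) * ρ 0 0);
      0, -(2 * G / C * (n + 1) * ρ 1 0)] := by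
    rw [hsolve hC2 (hF₁ ρ), sigmaPlus_mul, mul_sigmaPlus]
    ext i j
    fin_cases i <;> fin_cases j <;> simp <;> ring
  have eF₂ (ρ) : F₂ ρ = !![-(2 * G / B * n * ρ 0 1), 0;
      2 * G / B * ((n + 1) * ρ 0 0 - n * ρ 1 1), 2 * G / B * (n + 1) * ρ 0 1] := by
    rw [hsolve hB2 (hF₂ ρ), sigmaMinus_mul, mul_sigmaMinus]
    ext i j
    fin_cases i <;> fin_cases j <;> simp <;> ring
  have eL₂ (ρ) : L₂ ρ = !![(2 * G ^ 2 / B + 2 * G ^ 2 / C) * ((n + 1) * ρ 0 0 - n * ρ 1 1),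
      2 * G ^ 2 / B * (2 * n + 1) * ρ 0 1; 2 * G ^ 2 / C * (2 * n + 1) * ρ 1 0,
      -((2 * G ^ 2 / B + 2 * G ^ 2 / C) * ((n + 1) * ρ 0 0 - n * ρ 1 1))] := by
    rw [hL₂, eF₁, eF₂, sigmaMinus_mul, mul_sigmaMinus, sigmaPlus_mul, mul_sigmaPlus]
    ext i j
    fin_cases i <;> fin_cases j <;> simp <;> ring
  have eS₁ (ρ) : S₁ ρ = !![0, -(8 * G ^ 2 / C ^ 2 * n * (n + 1) * ρ 1 0); 0, 0] := by
    rw [hsolve hC (hS₁ ρ), eF₁, sigmaPlus_mul, mul_sigmaPlus]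
    ext i j
    fin_cases i <;> fin_cases j <;> simp; ring
  have eS₃ (ρ) : S₃ ρ = !![0, 0; -(8 * G ^ 2 / B ^ 2 * n * (n + 1) * ρ 0 1), 0] := by
    rw [hsolve hB (hS₃ ρ), eF₂, sigmaMinus_mul, mul_sigmaMinus]
    ext i j
    fin_cases i <;> fin_cases j <;> simp; ring
  have eS₂ (ρ) : S₂ ρ = !![γ⁻¹ * (n * (2 * G ^ 2 / B + 2 * G ^ 2 / C)
        * ((n + 1) * ρ 0 0 - n * ρ 1 1)),
      γ⁻¹ * (2 * G ^ 2 / B * 2 * n * (n + 1) * ρ 0 1);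
      γ⁻¹ * (2 * G ^ 2 / C * 2 * n * (n + 1) * ρ 1 0),
      -(γ⁻¹ * ((n + 1) * (2 * G ^ 2 / B + 2 * G ^ 2 / C)
        * ((n + 1) * ρ 0 0 - n * ρ 1 1)))] := by
    rw [hsolve hγ0 (hS₂ ρ), eF₁, eF₂, eL₂, sigmaMinus_mul, mul_sigmaPlus]
    ext i j
    fin_cases i <;> fin_cases j <;> simp [-mul_eq_mul_left_iff] <;> ring
  have hBC : B + C ≠ 0 := hγ ▸ mul_ne_zero two_ne_zero hγ0
  -- With `γ` eliminated, every entry becomes a rational identity in the independent variables `B`,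
  -- `C`, `G`, `n`; the primed coefficients are the unprimed ones with `B` and `C` exchanged.
  obtain rfl : γ = (B + C) / 2 := by rw [hγ]; ring
  rw [hL₄, hsolve hC2 (hT₁ ρ), hsolve hB2 (hT₂ ρ), eS₁, eS₂, eS₃, eF₁, eF₂, eL₂, sigmaMinus_mul,
    mul_sigmaMinus, sigmaPlus_mul, mul_sigmaPlus]
  simp only [sigmaMinus_mul, mul_sigmaMinus, sigmaPlus_mul, mul_sigmaPlus]
  subst hβm hβp hβm' hβp' hφ
  ext i j
  fin_cases i <;> fin_cases j <;>
    simp [-mul_eq_mul_left_iff, -mul_eq_mul_right_iff] <;> field_simp <;> ring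

/-! ### Traces of qubit superoperators -/

lemma trace_superop (L : QubitSuperop) :
    LinearMap.trace ℂ QubitOp L = ∑ i, ∑ j, L (Matrix.single i j 1) i j := by
  rw [LinearMap.trace_eq_matrix_trace ℂ (Matrix.stdBasis ℂ (Fin 2) (Fin 2)), Matrix.trace,
    Fintype.sum_prod_type]
  refine Finset.sum_congr rfl fun i _ => Finset.sum_congr rfl fun j _ => ?_
  rw [Matrix.diag_apply, LinearMap.toMatrix_apply, Matrix.stdBasis_eq_single]
  rfl

lemma trace_mulLeft_comp_mulRight (A B : QubitOp) :
    LinearMap.trace ℂ QubitOp (LinearMap.mulLeft ℂ A ∘ₗ LinearMap.mulRight ℂ B)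
      = A.trace * B.trace := by
  rw [trace_superop]
  simp [Matrix.trace, Matrix.mul_apply, Matrix.single_apply, Fin.sum_univ_two]
  ring

lemma trace_mulLeft (A : QubitOp) :
    LinearMap.trace ℂ QubitOp (LinearMap.mulLeft ℂ A) = 2 * A.trace := by
  simpa [mul_comm] using trace_mulLeft_comp_mulRight A 1

lemma trace_mulRight (A : QubitOp) :
    LinearMap.trace ℂ QubitOp (LinearMap.mulRight ℂ A) = 2 * A.trace := by
  simpa using trace_mulLeft_comp_mulRight 1 A

lemma trace_qubitCommutator (H : QubitOp) :
    LinearMap.trace ℂ QubitOp (qubitCommutator H) = 0 := by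
  rw [qubitCommutator, map_sub, trace_mulLeft, trace_mulRight, sub_self]

lemma trace_qubitDissipator (J : QubitOp) :
    LinearMap.trace ℂ QubitOp (qubitDissipator J)
      = J.trace * Jᴴ.trace - 2 * (Jᴴ * J).trace := by
  rw [qubitDissipator, map_sub, map_smul, map_add, trace_mulLeft_comp_mulRight, trace_mulLeft,
    trace_mulRight, smul_eq_mul]
  ring

lemma qubitCommutator_apply (H ρ : QubitOp) : qubitCommutator H ρ = H * ρ - ρ * H := rfl

lemma qubitDissipator_apply (J ρ : QubitOp) :
    qubitDissipator J ρ = J * ρ * Jᴴ - (1 / 2 : ℂ) • (Jᴴ * J * ρ + ρ * (Jᴴ * J)) := by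
  simp [qubitDissipator, mul_assoc]

/-! ### Lindblad generators -/

lemma IsLindblad.trace_apply {L : QubitSuperop} (hL : IsLindblad L) (ρ : QubitOp) :
    (L ρ).trace = 0 := by
  obtain ⟨H, -, r, J, rfl⟩ := hL
  have h1 : (qubitCommutator H ρ).trace = 0 := by
    rw [qubitCommutator_apply, Matrix.trace_sub, Matrix.trace_mul_comm, sub_self]
  have h2 (k : Fin r) : (qubitDissipator (J k) ρ).trace = 0 := by
    rw [qubitDissipator_apply, Matrix.trace_sub, Matrix.trace_smul, Matrix.trace_add,
      Matrix.trace_mul_comm (J k * ρ), ← Matrix.mul_assoc, Matrix.trace_mul_comm ρ, smul_eq_mul]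
    ring
  simp [LinearMap.sum_apply, Matrix.trace_sum, h1, h2]

lemma IsLindblad.conjTranspose_apply {L : QubitSuperop} (hL : IsLindblad L) (ρ : QubitOp) :
    (L ρ)ᴴ = L ρᴴ := by
  obtain ⟨H, hH, r, J, rfl⟩ := hL
  simp only [LinearMap.add_apply, LinearMap.smul_apply, LinearMap.sum_apply,
    qubitCommutator_apply, qubitDissipator_apply, Matrix.conjTranspose_add,
    Matrix.conjTranspose_smul, Matrix.conjTranspose_sum, Matrix.conjTranspose_sub,
    Matrix.conjTranspose_mul, Matrix.conjTranspose_conjTranspose, hH.eq]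
  congr 1
  · simp only [star_neg, Complex.star_def, Complex.conj_I, neg_neg, neg_smul, ← smul_neg, neg_sub]
  · refine Finset.sum_congr rfl fun k _ => ?_
    rw [add_comm (ρᴴ * _)]
    simp [mul_assoc]

/-- The traceless Hermitian matrix `x σ_x + y σ_y + z σ_z`. -/
def bloch (x y z : ℝ) : QubitOp := !![(z : ℂ), x - y * Complex.I; x + y * Complex.I, -z]

/-- For `P = bloch x y z` one has `P ^ 2 = |r|² 1`, and `J ↦ P J P` multiplies the components of `J`
along `1` and `P` by `|r|²` and the orthogonal ones by `-|r|²`. The trace of `P J P J†` is therefore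
fixed by `tr J`, `tr (J P)` and `tr (J† J)`. -/
lemma trace_bloch_mul_qubitDissipator (x y z : ℝ) (J : QubitOp) :
    (bloch x y z * qubitDissipator J (bloch x y z)).trace
      = (x ^ 2 + y ^ 2 + z ^ 2 : ℝ) * LinearMap.trace ℂ QubitOp (qubitDissipator J)
        + (Complex.normSq (J * bloch x y z).trace : ℂ) := by
  rw [trace_qubitDissipator, qubitDissipator_apply, Complex.normSq_eq_conj_mul_self]
  have hI : Complex.I ^ 2 = -1 := Complex.I_sq
  have e00 : bloch x y z 0 0 = z := rfl
  have e01 : bloch x y z 0 1 = x - y * Complex.I := rfl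
  have e10 : bloch x y z 1 0 = x + y * Complex.I := rfl
  have e11 : bloch x y z 1 1 = -z := rfl
  simp only [Matrix.trace_fin_two, Matrix.mul_apply, Fin.sum_univ_two, Matrix.sub_apply,
    Matrix.smul_apply, Matrix.add_apply, Matrix.conjTranspose_apply, smul_eq_mul, e00, e01, e10,
    e11, map_add, map_sub, map_neg, map_mul, Complex.conj_ofReal, Complex.conj_I,
    Complex.star_def]
  push_cast
  linear_combination ((y : ℂ) ^ 2 * (J 0 0 * (starRingEnd ℂ) (J 0 0) - J 0 0 * (starRingEnd ℂ) (J 1 1)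
    - J 1 1 * (starRingEnd ℂ) (J 0 0) + J 1 1 * (starRingEnd ℂ) (J 1 1)
    + 2 * J 0 1 * (starRingEnd ℂ) (J 0 1) + 2 * J 1 0 * (starRingEnd ℂ) (J 1 0))) * hI

lemma trace_bloch_mul_qubitCommutator (x y z : ℝ) (H : QubitOp) :
    (bloch x y z * qubitCommutator H (bloch x y z)).trace = 0 := by
  rw [qubitCommutator_apply, Matrix.mul_sub, Matrix.trace_sub, ← Matrix.mul_assoc,
    Matrix.trace_mul_comm, sub_self]

/-- The excess `w` is the sum of the squares `|tr (Jₖ P)|²`; its sign is the only consequence of the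
Lindblad form that the decay bound needs for nonzero Bloch vectors, besides trace preservation. -/
lemma IsLindblad.trace_bloch_mul {L : QubitSuperop} (hL : IsLindblad L) (x y z : ℝ) :
    ∃ w : ℝ, 0 ≤ w ∧ (bloch x y z * L (bloch x y z)).trace
      = (x ^ 2 + y ^ 2 + z ^ 2 : ℝ) * LinearMap.trace ℂ QubitOp L + w := by
  obtain ⟨H, -, r, J, rfl⟩ := hL
  refine ⟨∑ k, Complex.normSq (J k * bloch x y z).trace,
    Finset.sum_nonneg fun k _ => Complex.normSq_nonneg _, ?_⟩
  simp only [LinearMap.add_apply, LinearMap.smul_apply, LinearMap.sum_apply, Matrix.mul_smul,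
    Matrix.trace_add, Matrix.trace_smul, trace_bloch_mul_qubitCommutator, map_add, map_smul,
    map_sum, trace_qubitCommutator, Matrix.trace_sum, trace_bloch_mul_qubitDissipator,
    Finset.sum_add_distrib, Finset.mul_sum, mul_add, smul_zero, zero_add, Complex.ofReal_sum]

lemma IsLindblad.trace_re_nonpos {L : QubitSuperop} (hL : IsLindblad L) :
    (LinearMap.trace ℂ QubitOp L).re ≤ 0 := by
  obtain ⟨H, -, r, J, rfl⟩ := hL
  rw [map_add, map_smul, trace_qubitCommutator, smul_zero, zero_add, map_sum, Complex.re_sum]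
  refine Finset.sum_nonpos fun k _ => ?_
  rw [trace_qubitDissipator]
  simp [Matrix.trace, Matrix.mul_apply, Fin.sum_univ_two]
  -- `2 tr (J† J) - |tr J|² = |J₀₀ - J₁₁|² + 2 |J₀₁|² + 2 |J₁₀|²`.
  nlinarith [sq_nonneg ((J k 0 0).re - (J k 1 1).re), sq_nonneg ((J k 0 0).im - (J k 1 1).im),
    sq_nonneg (J k 0 1).re, sq_nonneg (J k 0 1).im, sq_nonneg (J k 1 0).re,
    sq_nonneg (J k 1 0).im]

lemma isHermitian_eq_smul_one_add_bloch {X : QubitOp} (hX : X.IsHermitian) :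
    ∃ c x y z : ℝ, X = (c : ℂ) • (1 : QubitOp) + bloch x y z := by
  have h00 := congrArg Complex.im (hX.apply 0 0)
  have h11 := congrArg Complex.im (hX.apply 1 1)
  have h10 := hX.apply 1 0
  have h10r := congrArg Complex.re h10
  have h10i := congrArg Complex.im h10
  simp at h00 h11 h10r h10i
  refine ⟨((X 0 0).re + (X 1 1).re) / 2, (X 0 1).re, -(X 0 1).im,
    ((X 0 0).re - (X 1 1).re) / 2, ?_⟩
  ext i j
  fin_cases i <;> fin_cases j <;> apply Complex.ext <;> simp [bloch] <;> linarith

/-- A Hermitian left eigenvector of a Lindblad generator, with a real eigenvalue, decays at most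
at half the total decay rate. -/
lemma IsLindblad.trace_le_of_isHermitian {L : QubitSuperop} (hL : IsLindblad L) {X : QubitOp}
    (hX : X.IsHermitian) (hX0 : X ≠ 0) {lam : ℝ}
    (h : ∀ ρ, (X * L ρ).trace = lam * (X * ρ).trace) :
    (LinearMap.trace ℂ QubitOp L).re ≤ 2 * lam := by
  obtain ⟨c, x, y, z, rfl⟩ := isHermitian_eq_smul_one_add_bloch hX
  -- The identity component of `X` drops out on the left because `L ρ` is traceless.
  have key (ρ : QubitOp) : (bloch x y z * L ρ).trace
      = lam * (c * ρ.trace + (bloch x y z * ρ).trace) := by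
    have := h ρ
    simpa [add_mul, Matrix.trace_add, hL.trace_apply] using this
  -- If `X` is a multiple of the identity, testing at `ρ = 1` forces `lam = 0`, and the bound is `tr
  -- L ≤ 0`.
  by_cases hr : x ^ 2 + y ^ 2 + z ^ 2 = 0
  · have hx : x = 0 := by nlinarith [sq_nonneg x, sq_nonneg y, sq_nonneg z]
    have hy : y = 0 := by nlinarith [sq_nonneg x, sq_nonneg y, sq_nonneg z]
    have hz : z = 0 := by nlinarith [sq_nonneg x, sq_nonneg y, sq_nonneg z]
    subst hx hy hz
    have hb : bloch 0 0 0 = 0 := by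
      ext i j; fin_cases i <;> fin_cases j <;> simp [bloch]
    rw [hb] at key hX0
    have hc : (c : ℂ) ≠ 0 := by
      rintro hc
      simp [hc] at hX0
    have h1 := key 1
    simp [hc] at h1
    rw [h1]
    simpa using hL.trace_re_nonpos
  · obtain ⟨w, hw, hw'⟩ := hL.trace_bloch_mul x y z
    -- Testing the eigenvector on its own Bloch part gives `|r|² tr L + w = 2 lam |r|²`.
    have h1 := key (bloch x y z)
    have ht : (bloch x y z).trace = 0 := by simp [bloch, Matrix.trace, Fin.sum_univ_two]
    have ht2 : (bloch x y z * bloch x y z).trace = (2 * (x ^ 2 + y ^ 2 + z ^ 2) : ℝ) := by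
      simp [bloch, Matrix.trace, Fin.sum_univ_two]
      ring_nf
      rw [Complex.I_sq]
      ring
    rw [hw', ht, ht2] at h1
    have h2 := congrArg Complex.re h1
    rw [Complex.add_re, Complex.re_ofReal_mul, Complex.ofReal_re, mul_zero, zero_add,
      Complex.re_ofReal_mul, Complex.ofReal_re] at h2
    have hpos : 0 < x ^ 2 + y ^ 2 + z ^ 2 := lt_of_le_of_ne (by positivity) (Ne.symm hr)
    nlinarith

/-- `L` commutes with the adjoint and `lam` is real, so `Xᴴ` is a left eigenvector too. Either `X +
Xᴴ` is a nonzero Hermitian eigenvector, or `X` is anti-Hermitian and `i X` is one. -/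
lemma IsLindblad.trace_le {L : QubitSuperop} (hL : IsLindblad L) {X : QubitOp}
    (hX0 : X ≠ 0) {lam : ℝ} (h : ∀ ρ, (X * L ρ).trace = lam * (X * ρ).trace) :
    (LinearMap.trace ℂ QubitOp L).re ≤ 2 * lam := by
  have h' (ρ : QubitOp) : (Xᴴ * L ρ).trace = lam * (Xᴴ * ρ).trace := by
    have h1 := congrArg star (h ρᴴ)
    rw [← Matrix.trace_conjTranspose, Matrix.conjTranspose_mul, hL.conjTranspose_apply,
      Matrix.conjTranspose_conjTranspose, Matrix.trace_mul_comm, star_mul', ←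
      Matrix.trace_conjTranspose, Matrix.conjTranspose_mul, Matrix.conjTranspose_conjTranspose,
      Matrix.trace_mul_comm ρ] at h1
    simpa using h1
  by_cases hs : X + Xᴴ = 0
  · have hX : Xᴴ = -X := (neg_eq_of_add_eq_zero_right hs).symm
    refine hL.trace_le_of_isHermitian (X := Complex.I • X) ?_ (smul_ne_zero Complex.I_ne_zero hX0)
      fun ρ => ?_
    · rw [Matrix.IsHermitian, Matrix.conjTranspose_smul, hX]
      simp
    · rw [smul_mul_assoc, Matrix.trace_smul, h, smul_mul_assoc, Matrix.trace_smul, smul_eq_mul,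
        smul_eq_mul]
      ring
  · refine hL.trace_le_of_isHermitian (X := X + Xᴴ) (Matrix.isHermitian_add_transpose_self X) hs
      fun ρ => ?_
    rw [add_mul, Matrix.trace_add, h, h', add_mul, Matrix.trace_add]
    ring

/-! ### Gauge transformations -/

lemma exists_isSolution (L : QubitSuperop) (ρ : QubitOp) :
    ∃ f : ℝ → QubitOp, f 0 = ρ ∧ IsSolution L f := by
  -- On the normed space of functions the solution is `exp (t L) ρ`, and derivatives are taken
  -- entrywise.
  let L' : (Fin 2 → Fin 2 → ℂ) →ₗ[ℂ] (Fin 2 → Fin 2 → ℂ) := L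
  let A : (Fin 2 → Fin 2 → ℂ) →L[ℂ] (Fin 2 → Fin 2 → ℂ) := L'.toContinuousLinearMap
  let v : Fin 2 → Fin 2 → ℂ := ρ
  refine ⟨fun t => NormedSpace.exp (t • A) v, ?_, fun t i j => ?_⟩
  · show NormedSpace.exp ((0 : ℝ) • A) v = v
    rw [show (0 : ℝ) • A = 0 from zero_smul ℝ A, NormedSpace.exp_zero]
    rfl
  · have h1 : HasDerivAt (fun s : ℝ => NormedSpace.exp (s • A)) (A * NormedSpace.exp (t • A)) t :=
      hasDerivAt_exp_smul_const' A t
    have h2 : HasDerivAt (fun s : ℝ => NormedSpace.exp (s • A) v)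
        ((A * NormedSpace.exp (t • A)) v) t := by
      have := (((ContinuousLinearMap.apply ℂ (Fin 2 → Fin 2 → ℂ) v).restrictScalars ℝ
        ).hasFDerivAt.comp_hasDerivAt t h1)
      exact this
    exact hasDerivAt_pi.1 (hasDerivAt_pi.1 h2 i) j

lemma superop_apply_eq_sum (G ρ) (i j : Fin 2) :
    (G : QubitSuperop) ρ i j = ∑ k, ∑ l, ρ k l * G (Matrix.single k l 1) i j := by
  conv_lhs => rw [Matrix.matrix_eq_sum_single ρ]
  simp only [map_sum, Matrix.sum_apply]
  refine Finset.sum_congr rfl fun k _ => Finset.sum_congr rfl fun l _ => ?_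
  rw [← mul_one (ρ k l), ← smul_eq_mul, ← Matrix.smul_single, map_smul, Matrix.smul_apply]
  simp

/-- Differentiate at time zero the image under `1 + G` of the solution that starts at `ρ`, in two
ways. -/
lemma IsGeneratorInGauge.intertwine {L G LG : QubitSuperop} (h : IsGeneratorInGauge L G LG)
    (ρ : QubitOp) : (1 + G) (LG ρ) = L ((1 + G) ρ) := by
  obtain ⟨f, hf0, hf⟩ := exists_isSolution LG ρ
  ext i j
  have h1 := (h f).1 hf 0 i j
  have h2 : HasDerivAt (fun t => (f t + G (f t)) i j) ((LG (f 0) + G (LG (f 0))) i j) 0 := by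
    have e : (fun t => (f t + G (f t)) i j)
        = fun t => f t i j + ∑ k, ∑ l, f t k l * G (Matrix.single k l 1) i j :=
      funext fun t => by rw [Matrix.add_apply, superop_apply_eq_sum G (f t)]
    rw [e, Matrix.add_apply, superop_apply_eq_sum G (LG (f 0))]
    refine (hf 0 i j).add ?_
    exact HasDerivAt.fun_sum fun k _ => HasDerivAt.fun_sum fun l _ =>
      (hf 0 k l).mul_const _
  have h3 := h2.unique h1
  simp only [hf0] at h3
  exact h3

lemma exists_trace_mul_eq (f : QubitOp →ₗ[ℂ] ℂ) :
    ∃ X : QubitOp, ∀ ρ, (X * ρ).trace = f ρ := by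
  refine ⟨Matrix.of fun i j => f (Matrix.single j i 1), fun ρ => ?_⟩
  conv_rhs => rw [Matrix.matrix_eq_sum_single ρ]
  have h (k l : Fin 2) : f (Matrix.single k l (ρ k l)) = ρ k l * f (Matrix.single k l 1) := by
    rw [← smul_eq_mul, ← map_smul, Matrix.smul_single, smul_eq_mul, mul_one]
  simp [h, Matrix.trace, Matrix.mul_apply, Fin.sum_univ_two]
  ring

/-- Lindblad generators decay at most at half the total decay rate, in every gauge. -/
lemma IsGeneratorInGauge.trace_le {L G LG : QubitSuperop} (h : IsGeneratorInGauge L G LG)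
    (hG : IsUnit (1 + G)) (hLG : IsLindblad LG) {X : QubitOp} (hX : X ≠ 0) {lam : ℝ}
    (hXL : ∀ ρ, (X * L ρ).trace = lam * (X * ρ).trace) :
    (LinearMap.trace ℂ QubitOp L).re ≤ 2 * lam := by
  have hi : (1 + G) * LG = L * (1 + G) := LinearMap.ext h.intertwine
  obtain ⟨u, hu⟩ := hG
  rw [← hu] at hi
  have hL : L = u * LG * (u⁻¹ : Units _) := by rw [hi]; simp
  have htr : LinearMap.trace ℂ QubitOp L = LinearMap.trace ℂ QubitOp LG := by
    rw [hL, LinearMap.trace_mul_comm, ← mul_assoc]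
    simp
  -- `Y` is the pullback of `X` along `1 + G`: a left eigenvector of `LG` with the same eigenvalue,
  -- nonzero because `1 + G` is invertible.
  obtain ⟨Y, hY⟩ := exists_trace_mul_eq
    ((Matrix.traceLinearMap (Fin 2) ℂ ℂ ∘ₗ LinearMap.mulLeft ℂ X) ∘ₗ (u : QubitSuperop))
  simp only [LinearMap.comp_apply, LinearMap.mulLeft_apply, Matrix.traceLinearMap_apply] at hY
  rw [htr]
  refine hLG.trace_le (X := Y) ?_ fun ρ => ?_
  · rintro rfl
    apply hX
    ext i j
    have := hY ((u⁻¹ : Units _).val (Matrix.single j i 1))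
    rw [← Module.End.mul_apply, Units.mul_inv] at this
    simpa [Matrix.trace_mul_single] using this.symm
  · rw [hY, hY, ← Module.End.mul_apply, hi, Module.End.mul_apply, hXL]

/-! ### The coefficients of the reduced generator -/

lemma star_gammaBar (Δ γ : ℝ) : star (gammaBar Δ γ) = γ - 2 * Complex.I * Δ := by
  simp [gammaBar]
  ring

lemma gammaBar_ne_zero (Δ : ℝ) {γ : ℝ} (hγ : 0 < γ) : gammaBar Δ γ ≠ 0 := by
  intro h
  have := congrArg Complex.re h
  simp [gammaBar] at this
  exact hγ.ne' this

/-- With `B = gammaBar` and `C` its conjugate, `‖B‖² = B C` and `8 i γ Δ = B² - C²`. This makes the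
coefficient rational in `B`, `C` and `-i g`. Only even powers of `-i g` occur, so conjugation just
exchanges `B` and `C`. -/
lemma bCoeff_eq (Δ γ nth g n : ℝ) :
    bCoeff Δ γ nth g n = -2 * (-Complex.I * g) ^ 2 * n / gammaBar Δ γ
      + 8 * (-Complex.I * g) ^ 4 * n ^ 2 / gammaBar Δ γ ^ 3
      + 8 * (-Complex.I * g) ^ 4 * nth * (nth + 1)
        * (1 + (gammaBar Δ γ ^ 2 - star (gammaBar Δ γ) ^ 2)
            / (gammaBar Δ γ * star (gammaBar Δ γ)))
        / (star (gammaBar Δ γ) * (gammaBar Δ γ * star (gammaBar Δ γ))) := by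
  have hn : ((‖gammaBar Δ γ‖ ^ 2 : ℝ) : ℂ) = gammaBar Δ γ * star (gammaBar Δ γ) := by
    rw [Complex.star_def, Complex.mul_conj, Complex.normSq_eq_norm_sq]
  have hI : (-Complex.I * g) ^ 2 = -g ^ 2 := by
    rw [mul_pow, neg_sq, Complex.I_sq, neg_one_mul]
  have hI4 : (-Complex.I * g) ^ 4 = g ^ 4 := by
    rw [show (4 : ℕ) = 2 * 2 from rfl, pow_mul, hI]; ring
  have hd : gammaBar Δ γ ^ 2 - star (gammaBar Δ γ) ^ 2 = 8 * Complex.I * γ * Δ := by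
    rw [star_gammaBar, gammaBar]; ring
  rw [bCoeff, hn, hI, hI4, hd]
  ring

lemma star_bCoeff_eq (Δ γ nth g n : ℝ) :
    star (bCoeff Δ γ nth g n) = -2 * (-Complex.I * g) ^ 2 * n / star (gammaBar Δ γ)
      + 8 * (-Complex.I * g) ^ 4 * n ^ 2 / star (gammaBar Δ γ) ^ 3
      + 8 * (-Complex.I * g) ^ 4 * nth * (nth + 1)
        * (1 + (star (gammaBar Δ γ) ^ 2 - gammaBar Δ γ ^ 2)
            / (gammaBar Δ γ * star (gammaBar Δ γ)))
        / (gammaBar Δ γ * (gammaBar Δ γ * star (gammaBar Δ γ))) := by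
  have hI : (Complex.I * g) ^ 2 = (-Complex.I * g) ^ 2 := by ring
  have hI4 : (Complex.I * g) ^ 4 = (-Complex.I * g) ^ 4 := by ring
  rw [bCoeff_eq, ← hI, ← hI4]
  simp only [Complex.star_def, map_add, map_sub, map_mul, map_div₀, map_pow, map_neg, map_one,
    map_ofNat, Complex.conj_I, Complex.conj_ofReal, Complex.conj_conj, ← hI, ← hI4,
    mul_comm ((starRingEnd ℂ) (gammaBar Δ γ)) (gammaBar Δ γ)]

lemma ofReal_gammaPhi_eq (Δ nth g : ℝ) {γ : ℝ} (hγ : 0 < γ) :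
    ((gammaPhi Δ γ nth g : ℝ) : ℂ) = -8 * (-Complex.I * g) ^ 4 * nth * (nth + 1)
      * (3 * γ ^ 4 + 6 * γ ^ 2 * ((gammaBar Δ γ - star (gammaBar Δ γ)) / 2) ^ 2
        - ((gammaBar Δ γ - star (gammaBar Δ γ)) / 2) ^ 4)
      / (γ * (gammaBar Δ γ * star (gammaBar Δ γ)) ^ 3) := by
  have hI4 : (-Complex.I * g) ^ 4 = ((g ^ 4 : ℝ) : ℂ) := by
    rw [mul_pow, neg_pow, Complex.I_pow_four]; push_cast; ring
  have hd : ((gammaBar Δ γ - star (gammaBar Δ γ)) / 2) ^ 2 = ((-4 * Δ ^ 2 : ℝ) : ℂ) := by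
    rw [star_gammaBar, gammaBar]
    push_cast
    linear_combination 4 * (Δ : ℂ) ^ 2 * Complex.I_sq
  have hd4 : ((gammaBar Δ γ - star (gammaBar Δ γ)) / 2) ^ 4 = ((16 * Δ ^ 4 : ℝ) : ℂ) := by
    rw [show (4 : ℕ) = 2 * 2 from rfl, pow_mul, hd]; push_cast; ring
  have hm : gammaBar Δ γ * star (gammaBar Δ γ) = ((γ ^ 2 + 4 * Δ ^ 2 : ℝ) : ℂ) := by
    rw [star_gammaBar, gammaBar]
    push_cast
    linear_combination (-4) * (Δ : ℂ) ^ 2 * Complex.I_sq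
  have h1 : γ ^ 2 + 4 * Δ ^ 2 ≠ 0 := by positivity
  have h2 : 1 + (2 * Δ / γ) ^ 2 = (γ ^ 2 + 4 * Δ ^ 2) / γ ^ 2 := by field_simp; ring
  have h3 : gammaPhi Δ γ nth g = -8 * g ^ 4 * nth * (nth + 1)
      * (3 * γ ^ 4 + 6 * γ ^ 2 * (-4 * Δ ^ 2) - 16 * Δ ^ 4)
      / (γ * (γ ^ 2 + 4 * Δ ^ 2) ^ 3) := by
    rw [gammaPhi, h2]
    field_simp
    ring
  rw [hI4, hd, hd4, hm, h3]
  push_cast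
  ring

/-- The populations see `2 Re b = b + b*`; in the coherences the frequency shift and the damping
combine into `b₋ + b₊` or its conjugate. -/
lemma reducedGenerator_apply_eq_bCoeff (Δ γ nth g : ℝ) (ρ : QubitOp) :
    reducedGenerator Δ γ nth g ρ
      = !![-(bCoeff Δ γ nth g (1 + nth) + star (bCoeff Δ γ nth g (1 + nth))) * ρ 0 0
            + (bCoeff Δ γ nth g nth + star (bCoeff Δ γ nth g nth)) * ρ 1 1,
          (-(bCoeff Δ γ nth g (1 + nth) + bCoeff Δ γ nth g nth)
            - 2 * gammaPhi Δ γ nth g) * ρ 0 1;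
          (-(star (bCoeff Δ γ nth g (1 + nth)) + star (bCoeff Δ γ nth g nth))
            - 2 * gammaPhi Δ γ nth g) * ρ 1 0,
          (bCoeff Δ γ nth g (1 + nth) + star (bCoeff Δ γ nth g (1 + nth))) * ρ 0 0
            - (bCoeff Δ γ nth g nth + star (bCoeff Δ γ nth g nth)) * ρ 1 1] := by
  have hm : ((gammaMinus Δ γ nth g : ℝ) : ℂ)
      = bCoeff Δ γ nth g (1 + nth) + star (bCoeff Δ γ nth g (1 + nth)) := by
    rw [Complex.star_def, Complex.add_conj, gammaMinus]
  have hp : ((gammaPlus Δ γ nth g : ℝ) : ℂ)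
      = bCoeff Δ γ nth g nth + star (bCoeff Δ γ nth g nth) := by
    rw [Complex.star_def, Complex.add_conj, gammaPlus]
  have hω : Complex.I * omegaB Δ γ nth g = (bCoeff Δ γ nth g (1 + nth) + bCoeff Δ γ nth g nth
      - star (bCoeff Δ γ nth g (1 + nth) + bCoeff Δ γ nth g nth)) / 2 := by
    rw [Complex.star_def, Complex.sub_conj, omegaB]
    push_cast
    ring
  rw [reducedGenerator_apply, neg_mul Complex.I, hω, hm, hp, star_add]
  congr! 4 <;> ring

/-! ### The generator of an adiabatic elimination -/

section Elimination

variable {Δ γ nth g : ℝ} {N : ℕ} {K : ℕ → QubitOp →ₗ[ℂ] TotalOp} {Ls : ℕ → QubitSuperop}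

lemma momentRate_ne_zero (Δ : ℝ) {γ : ℝ} (hγ : 0 < γ) {p q : ℕ} (h : p + q ≠ 0) :
    momentRate Δ γ p q ≠ 0 := by
  intro h0
  have h1 := congrArg Complex.re h0
  have h2 : (0 : ℝ) < (p : ℝ) + q := by exact_mod_cast Nat.pos_of_ne_zero h
  simp [momentRate] at h1
  have h3 : ((p : ℂ) + q).re = p + q := by simp
  rcases h1 with h1 | h1
  · linarith
  · exact hγ.ne' h1

theorem IsPartialTraceElimination.sum_eq_reducedGenerator (hγ : 0 < γ) (hnth : 0 ≤ nth)
    (E : IsPartialTraceElimination Δ γ nth g 4 K Ls) :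
    ∑ n ∈ Finset.range 5, Ls n = reducedGenerator Δ γ nth g := by
  have hγ' : (γ : ℂ) ≠ 0 := Complex.ofReal_ne_zero.2 hγ.ne'
  have r10 : momentRate Δ γ 1 0 = star (gammaBar Δ γ) / 2 := by
    rw [star_gammaBar, momentRate]; push_cast; ring
  have r01 : momentRate Δ γ 0 1 = gammaBar Δ γ / 2 := by
    rw [gammaBar, momentRate]; push_cast; ring
  have r20 : momentRate Δ γ 2 0 = star (gammaBar Δ γ) := by
    rw [star_gammaBar, momentRate]; push_cast; ring
  have r02 : momentRate Δ γ 0 2 = gammaBar Δ γ := by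
    rw [gammaBar, momentRate]; push_cast; ring
  have r11 : momentRate Δ γ 1 1 = γ := by
    rw [momentRate]; push_cast; ring
  have r21 : momentRate Δ γ 2 1 = γ + momentRate Δ γ 1 0 := by
    rw [momentRate, momentRate]; push_cast; ring
  have r12 : momentRate Δ γ 1 2 = γ + momentRate Δ γ 0 1 := by
    rw [momentRate, momentRate]; push_cast; ring
  have hne (p q : ℕ) (h : p + q ≠ 0) {X : QubitOp} (hX : momentRate Δ γ p q • X = 0) : X = 0 :=
    (smul_eq_zero.1 hX).resolve_left (momentRate_ne_zero Δ hγ h)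
  have z00 (ρ) := (E.moment_zeroth hnth ρ).1
  have zne (ρ) := (E.moment_zeroth hnth ρ).2.1
  have z11 (ρ) := (E.moment_zeroth hnth ρ).2.2.1
  have z22 (ρ) := (E.moment_zeroth hnth ρ).2.2.2
  have t1 (ρ) : moment 0 0 (K 1 ρ) = 0 := by
    rw [moment_zero_zero]; exact E.gauge 1 le_rfl (by norm_num) ρ
  have t2 (ρ) : moment 0 0 (K 2 ρ) = 0 := by
    rw [moment_zero_zero]; exact E.gauge 2 (by norm_num) (by norm_num) ρ
  -- The thermal state has only moments with `p = q`, and the interaction changes `p - q` by one.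
  -- The odd orders `Ls 1` and, below, `Ls 3` vanish for this reason.
  have l1 (ρ) : Ls 1 ρ = 0 := by
    rw [E.Ls_succ hnth (n := 0) (by norm_num), zne ρ 1 0 (by norm_num), zne ρ 0 1 (by norm_num)]
    simp
  have m1 := E.moment_succ (n := 0) (by norm_num)
  have m2 := E.moment_succ (n := 1) (by norm_num)
  have m3 := E.moment_succ (n := 2) (by norm_num)
  simp only [Finset.sum_range_succ, Finset.sum_range_zero, zero_add, Nat.sub_zero,
    Nat.add_one_sub_one, Nat.reduceAdd, Nat.reduceSub, l1, map_zero, moment_zero, add_zero,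
    sub_zero] at m1 m2 m3
  have a11 (ρ) : moment 1 1 (K 1 ρ) = 0 := hne 1 1 (by norm_num) (by
    rw [m1 1 1 ρ]; simp [t1, zne])
  have a20 (ρ) : moment 2 0 (K 1 ρ) = 0 := hne 2 0 (by norm_num) (by
    rw [m1 2 0 ρ]; simp [zne])
  have a02 (ρ) : moment 0 2 (K 1 ρ) = 0 := hne 0 2 (by norm_num) (by
    rw [m1 0 2 ρ]; simp [zne])
  have a30 (ρ) : moment 3 0 (K 1 ρ) = 0 := hne 3 0 (by norm_num) (by
    rw [m1 3 0 ρ]; simp [zne])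
  have a03 (ρ) : moment 0 3 (K 1 ρ) = 0 := hne 0 3 (by norm_num) (by
    rw [m1 0 3 ρ]; simp [zne])
  have b10 (ρ) : moment 1 0 (K 2 ρ) = 0 := hne 1 0 (by norm_num) (by
    rw [m2 1 0 ρ]; simp [zne, t1, a20, a11])
  have b01 (ρ) : moment 0 1 (K 2 ρ) = 0 := hne 0 1 (by norm_num) (by
    rw [m2 0 1 ρ]; simp [zne, t1, a02, a11])
  have l3 (ρ) : Ls 3 ρ = 0 := by
    rw [E.Ls_succ hnth (n := 2) (by norm_num), b10, b01]
    simp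
  have a10 (ρ) : momentRate Δ γ 1 0 • moment 1 0 (K 1 ρ) = (-Complex.I * g : ℂ)
      • ((nth : ℂ) • (sigmaPlus * ρ) - (nth + 1 : ℂ) • (ρ * sigmaPlus)) := by
    rw [m1 1 0 ρ]
    simp [zne, z00, z11, -neg_mul, -neg_smul]
    module
  have a01 (ρ) : momentRate Δ γ 0 1 • moment 0 1 (K 1 ρ) = (-Complex.I * g : ℂ)
      • ((nth + 1 : ℂ) • (sigmaMinus * ρ) - (nth : ℂ) • (ρ * sigmaMinus)) := by
    rw [m1 0 1 ρ]
    simp [zne, z00, z11, -neg_mul, -neg_smul]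
    module
  -- The rates satisfy `r21 = γ + r10`, so the difference of the two sides is annihilated by the
  -- nonzero rate `r21`. This reduces the cubic moments to the linear ones.
  have a21 (ρ) : moment 2 1 (K 1 ρ) = (2 * nth : ℂ) • moment 1 0 (K 1 ρ) := by
    rw [← sub_eq_zero]
    refine hne 2 1 (by norm_num) ?_
    have e (X Y : QubitOp) : momentRate Δ γ 2 1 • (X - (2 * nth : ℂ) • Y) = momentRate Δ γ 2 1 • X
        - (2 * nth * γ : ℂ) • Y - (2 * nth : ℂ) • (momentRate Δ γ 1 0 • Y) := by
      rw [r21]; module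
    rw [e, m1 2 1, a10]
    simp [zne, z11, z22, -neg_mul, -neg_smul]
    module
  have a12 (ρ) : moment 1 2 (K 1 ρ) = (2 * nth : ℂ) • moment 0 1 (K 1 ρ) := by
    rw [← sub_eq_zero]
    refine hne 1 2 (by norm_num) ?_
    have e (X Y : QubitOp) : momentRate Δ γ 1 2 • (X - (2 * nth : ℂ) • Y) = momentRate Δ γ 1 2 • X
        - (2 * nth * γ : ℂ) • Y - (2 * nth : ℂ) • (momentRate Δ γ 0 1 • Y) := by
      rw [r12]; module
    rw [e, m1 1 2, a01]
    simp [zne, z11, z22, -neg_mul, -neg_smul]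
    module
  have l2 := E.Ls_succ hnth (n := 1) (by norm_num)
  have l4 := E.Ls_succ hnth (n := 3) (by norm_num)
  have b20 (ρ) : momentRate Δ γ 2 0 • moment 2 0 (K 2 ρ) = (-Complex.I * g : ℂ)
      • ((2 * nth : ℂ) • (sigmaPlus * moment 1 0 (K 1 ρ))
        - (2 * (nth + 1) : ℂ) • (moment 1 0 (K 1 ρ) * sigmaPlus)) := by
    rw [m2 2 0 ρ]
    simp [zne, a30, a21, -neg_mul, -neg_smul]
    module
  have b02 (ρ) : momentRate Δ γ 0 2 • moment 0 2 (K 2 ρ) = (-Complex.I * g : ℂ)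
      • ((2 * (nth + 1) : ℂ) • (sigmaMinus * moment 0 1 (K 1 ρ))
        - (2 * nth : ℂ) • (moment 0 1 (K 1 ρ) * sigmaMinus)) := by
    rw [m2 0 2 ρ]
    simp [zne, a03, a12, -neg_mul, -neg_smul]
    module
  -- The cubic moments contribute `2 nth • Ls 2 ρ` and the term `K 0 (Ls 2 ρ)` subtracts `nth • Ls 2
  -- ρ`.
  have b11 (ρ) : momentRate Δ γ 1 1 • moment 1 1 (K 2 ρ) = (nth : ℂ) • Ls 2 ρ + (-Complex.I * g : ℂ)
      • (sigmaMinus * moment 1 0 (K 1 ρ) - moment 0 1 (K 1 ρ) * sigmaPlus) := by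
    rw [m2 1 1 ρ, z11, l2]
    simp [t2, a21, a12, -neg_mul, -neg_smul]
    module
  have c10 (ρ) : momentRate Δ γ 1 0 • moment 1 0 (K 3 ρ) = (-Complex.I * g : ℂ)
      • (sigmaMinus * moment 2 0 (K 2 ρ) - moment 2 0 (K 2 ρ) * sigmaMinus
        + (sigmaPlus * moment 1 1 (K 2 ρ) - moment 1 1 (K 2 ρ) * sigmaPlus))
      - moment 1 0 (K 1 (Ls 2 ρ)) := by
    rw [m3 1 0 ρ]
    simp [zne, t2]
  have c01 (ρ) : momentRate Δ γ 0 1 • moment 0 1 (K 3 ρ) = (-Complex.I * g : ℂ)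
      • (sigmaMinus * moment 1 1 (K 2 ρ) - moment 1 1 (K 2 ρ) * sigmaMinus
        + (sigmaPlus * moment 0 2 (K 2 ρ) - moment 0 2 (K 2 ρ) * sigmaPlus))
      - moment 0 1 (K 1 (Ls 2 ρ)) := by
    rw [m3 0 1 ρ]
    simp [zne, t2]
  rw [r10] at a10 c10
  rw [r01] at a01 c01
  rw [r20] at b20
  rw [r02] at b02
  rw [r11] at b11
  have hB := gammaBar_ne_zero Δ hγ
  have hsum : gammaBar Δ γ + star (gammaBar Δ γ) = 2 * γ := by
    rw [star_gammaBar, gammaBar]; ring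
  refine LinearMap.ext fun ρ => ?_
  have hm := bCoeff_eq Δ γ nth g (1 + nth)
  have hm' := star_bCoeff_eq Δ γ nth g (1 + nth)
  rw [Complex.ofReal_add, Complex.ofReal_one, add_comm (1 : ℂ)] at hm hm'
  have h := fourth_order_of_moment_equations hB (star_ne_zero.2 hB) hγ' hsum a10 a01 l2 b20 b11
    b02 c10 c01 l4 hm (bCoeff_eq Δ γ nth g nth) hm' (star_bCoeff_eq Δ γ nth g nth)
    (ofReal_gammaPhi_eq Δ nth g hγ) ρ
  simp only [Finset.sum_range_succ, Finset.sum_range_zero, LinearMap.add_apply, E.Ls_zero,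
    l1, l3, zero_add, add_zero]
  rw [reducedGenerator_apply_eq_bCoeff]
  exact h

end Elimination

/-- A negative dephasing rate excludes the Lindblad form in every gauge. -/
theorem IsGeneratorInGauge.gammaPhi_nonneg {Δ γ nth g : ℝ} {G LG : QubitSuperop}
    (h : IsGeneratorInGauge (reducedGenerator Δ γ nth g) G LG) (hG : IsUnit (1 + G))
    (hLG : IsLindblad LG) : 0 ≤ gammaPhi Δ γ nth g := by
  have htr : (LinearMap.trace ℂ QubitOp (reducedGenerator Δ γ nth g)).re
      = -2 * (gammaMinus Δ γ nth g + gammaPlus Δ γ nth g) - 4 * gammaPhi Δ γ nth g := by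
    simp [trace_superop, reducedGenerator_apply, Fin.sum_univ_two]
    ring
  -- For `s = 0` the eigenvector used below may vanish; trace preservation supplies the left
  -- eigenvector `1` with eigenvalue zero instead.
  by_cases h0 : gammaMinus Δ γ nth g + gammaPlus Δ γ nth g = 0
  · have h1 := h.trace_le hG hLG (X := 1) one_ne_zero (lam := 0) fun ρ => by
      simp [reducedGenerator_apply, Matrix.trace_fin_two]
    rw [htr] at h1
    linarith
  set s := gammaMinus Δ γ nth g + gammaPlus Δ γ nth g with hs
  have hs' : (s : ℂ) = gammaMinus Δ γ nth g + gammaPlus Δ γ nth g := by rw [hs]; push_cast; rfl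
  -- The population imbalance `γ₋ ρ₀₀ - γ₊ ρ₁₁` decays at the rate `s`; it is a nonzero functional
  -- unless both rates vanish.
  have h1 := h.trace_le hG hLG (lam := -s)
    (X := !![2 * (gammaMinus Δ γ nth g : ℂ), 0; 0, -2 * (gammaPlus Δ γ nth g : ℂ)])
    (fun hX => h0 (by
      have e0 := congrFun (congrFun hX 0) 0
      have e1 := congrFun (congrFun hX 1) 1
      simp at e0 e1
      rw [hs, e0, e1, add_zero]))
    fun ρ => by
      simp only [Matrix.trace_fin_two, Matrix.mul_apply, Fin.sum_univ_two]
      simp [reducedGenerator_apply, hs']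
      ring
  rw [htr] at h1
  linarith

end JaynesCummings

end

open JaynesCummings in
theorem mainTheorem1 (Δ γ nth g : ℝ) (hγ : 0 < γ) (hnth : 0 ≤ nth) :
    (∀ (K : ℕ → QubitOp →ₗ[ℂ] TotalOp) (Ls : ℕ → QubitSuperop),
      IsPartialTraceElimination Δ γ nth g 4 K Ls →
        ∑ n ∈ Finset.range 5, Ls n = reducedGenerator Δ γ nth g) ∧
    (gammaPhi Δ γ nth g < 0 →
      ∀ G : QubitSuperop, IsUnit (1 + G) →
        ∀ LG : QubitSuperop, IsGeneratorInGauge (reducedGenerator Δ γ nth g) G LG →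
          ¬ IsLindblad LG) :=
  ⟨fun _ _ E => E.sum_eq_reducedGenerator hγ hnth,
    fun hφ _ hG _ h hLG => hφ.not_ge (h.gammaPhi_nonneg hG hLG)⟩
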